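/- Let $\zeta=e^{2\pi i/8}$, let $\sigma$ be the automorphism of $\mathbb{Q}(\zeta)$ with $\sigma(\zeta)=\zeta^3$, which restricts to the non-trivial automorphism of $K=\mathbb{Q}(\sqrt2)$, and let $N(x)=x\,\sigma(x)$ for $x\in K$. Let $\lambda=1+\sqrt2$ and let $\mathbb{P}$ be the set of prime elements $\pi$ of $\mathbb{Z}[\sqrt2]$ with $1<\pi<\lambda$. For a bounded set $\mathcal{W}\subset\mathbb{C}$ put $\mathcal{A}_{\mathcal{W}}=\{x\in\mathbb{Z}[\zeta]\mid \sigma(x)\in\mathcal{W}\}$. For a locally finite $\mathcal{Q}\subset\mathbb{C}$ let $\widehat{\mathcal{Q}}=\{x\in\mathcal{Q}\mid tx\notin\mathcal{Q}\ \forall t\in(0,1)\}$ be its set of visible points; write $\theta(\mathcal{Q})=\theta$ if $\#(\mathcal{Q}\cap TD)/\mathrm{vol}(TD)\to\theta$ as $T\to\infty$ for every Jordan measurable $D\subset\mathbb{C}$ with $\mathrm{vol}(D)>0$; and call $C\subset\mathbb{R}_{>1}$ a set of occlusion quotients for $\mathcal{Q}$ if for each $x\in\mathcal{Q}\setminus\widehat{\mathcal{Q}}$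 there is $c\in C$ with $x/c\in\mathcal{Q}$. **Theorem.** Let $\mathcal{W}\subset\mathbb{C}$ be Jordan measurable, star-shaped with respect to the origin, and contain a neighbourhood of the origin, and let $r\ge1$ satisfy $-\mathcal{W}\subset r\mathcal{W}$. Let $P=\{\pi_1,\dots,\pi_n\}$ be the (finite) set of all $\pi\in\mathbb{P}$ with $|\sigma(\pi)|\le r$. For integers $k_0\le0$, $k_1$, $m_1,\dots,m_n$ put $$M=\{\pi_1^{m_1},\dots,\pi_n^{m_n}\}\cup\Big(\Big\{\lambda^k\prod_{i=1}^n\pi_i^{e_i}\ \Big|\ k_0\le k\le k_1,\ -m_i<e_i<m_i\Big\}\cap(1,\infty)\Big).$$ 1. The integers $k_0\le 0$, $k_1$, $m_1,\dots,m_n$ can be chosen so that $(\mathbb{P}\setminus P)\cup M$ is a set of occlusion quotients for $\mathcal{A}_{\mathcal{W}}$. 2. For every choice of these integers such that $(\mathbb{P}\setminus P)\cup M$ is a set of occlusion quotients for $\mathcal{A}_{\mathcal{W}}$, the density $\theta(\widehat{\mathcal{A}_{\mathcal{W}}})$ exists and $$\theta(\widehat{\mathcal{A}_{\mathcal{W}}})=\Big(4\,\zeta_{\mathbb{Q}(\sqrt2)}(2)\prod_{\pi\in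 P}\Big(1-\frac1{N(\pi)^2}\Big)\Big)^{-1}\sum_{M_0\subset M}\frac{(-1)^{\#M_0}\,\mathrm{vol}(\mathcal{W}_{M_0})}{N(\Pi_{M_0})^2},$$ where $\mathcal{W}_{M_0}=\mathcal{W}\cap\bigcap_{c\in M_0}\sigma(c)\mathcal{W}$, and $\Pi_{M_0}\in\mathbb{Z}[\sqrt2]$ is a least common multiple (which exists) of the numerators of the elements of $M_0$, each written as a fraction of relatively prime elements of $\mathbb{Z}[\sqrt2]$. Here $\zeta_{\mathbb{Q}(\sqrt2)}$ is the Dedekind zeta function. -/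

import Mathlib

open scoped Pointwise Topology NumberField IntermediateField

noncomputable section

namespace AmmannBeenker

/-! ### Densities, visible points, occlusion quotients -/

/-- A set is Jordan measurable if it is bounded and its boundary is a Lebesgue null set. -/
def JordanMeasurable (D : Set ℂ) : Prop :=
  Bornology.IsBounded D ∧ MeasureTheory.volume (frontier D) = 0

/-- The planar point set `Q` is locally finite and has asymptotic density `θ`:
`#(Q ∩ TD) / vol(TD) → θ` as `T → ∞` for all Jordan measurable `D` of positive volume. -/
def HasDensity (Q : Set ℂ) (θ : ℝ) : Prop :=
  (∀ B : Set ℂ, Bornology.IsBounded B → (Q ∩ B).Finite) ∧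
  ∀ D : Set ℂ, JordanMeasurable D → 0 < MeasureTheory.volume D →
    Filter.Tendsto
      (fun T : ℝ => ((Q ∩ T • D).ncard : ℝ) / MeasureTheory.volume.real (T • D))
      Filter.atTop (𝓝 θ)

/-- The points of `Q` visible from the origin. -/
def visible (Q : Set ℂ) : Set ℂ :=
  {x | x ∈ Q ∧ ∀ t : ℝ, 0 < t → t < 1 → (t : ℂ) * x ∉ Q}

/-- `C ⊆ (1, ∞)` is a set of occlusion quotients for `Q`: every invisible point `x` of `Q` has
`x / c ∈ Q` for some `c ∈ C`. -/
def IsOcclusionQuotients (Q : Set ℂ) (C : Set ℝ) : Prop :=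
  (∀ c ∈ C, 1 < c) ∧ ∀ x ∈ Q \ visible Q, ∃ c ∈ C, x / (c : ℂ) ∈ Q

/-! ### The field `ℚ(ζ)`, `ζ = exp(2πi/8)`, and the sets `A_W` -/

/-- The eighth root of unity `ζ = exp(2πi/8)`. -/
def zeta8 : ℂ := Complex.exp (2 * Real.pi * Complex.I / 8)

theorem zeta8_isPrimitiveRoot : IsPrimitiveRoot zeta8 8 := by
  have h := Complex.isPrimitiveRoot_exp 8 (by norm_num)
  simpa [zeta8] using h

theorem zeta8_isIntegral : IsIntegral ℚ zeta8 :=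
  (zeta8_isPrimitiveRoot.isIntegral (by norm_num)).tower_top

/-- The cyclotomic field `ℚ(ζ) ⊆ ℂ`. -/
abbrev Q8 : IntermediateField ℚ ℂ := ℚ⟮zeta8⟯

instance : FiniteDimensional ℚ Q8 :=
  IntermediateField.adjoin.finiteDimensional zeta8_isIntegral

/-- `ζ` as an element of `ℚ(ζ)`. -/
def zetaGen : Q8 := IntermediateField.AdjoinSimple.gen ℚ zeta8

theorem aeval_zetaGen_cube :
    Polynomial.aeval (zetaGen ^ 3)
      (minpoly ℚ (IntermediateField.adjoin.powerBasis zeta8_isIntegral).gen) = 0 := by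
  have hg : IsPrimitiveRoot zetaGen 8 :=
    IsPrimitiveRoot.coe_submonoidClass_iff.mp zeta8_isPrimitiveRoot
  have h3 : IsPrimitiveRoot (zetaGen ^ 3) 8 := hg.pow_of_coprime 3 (by norm_num)
  have e1 := Polynomial.cyclotomic_eq_minpoly_rat hg (by norm_num)
  have e3 := Polynomial.cyclotomic_eq_minpoly_rat h3 (by norm_num)
  rw [IntermediateField.adjoin.powerBasis_gen]
  change Polynomial.aeval (zetaGen ^ 3) (minpoly ℚ zetaGen) = 0
  rw [← e1, e3]
  exact minpoly.aeval _ _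

/-- The automorphism `σ` of `ℚ(ζ)` determined by `σ(ζ) = ζ ^ 3`. -/
def sigma8 : Q8 ≃ₐ[ℚ] Q8 :=
  AlgEquiv.ofBijective
    ((IntermediateField.adjoin.powerBasis zeta8_isIntegral).lift (zetaGen ^ 3) aeval_zetaGen_cube)
    (Algebra.IsAlgebraic.algHom_bijective _)

theorem sigma8_zeta : sigma8 zetaGen = zetaGen ^ 3 :=
  (IntermediateField.adjoin.powerBasis zeta8_isIntegral).lift_gen _ aeval_zetaGen_cube

/-- `A_W = {x ∈ ℤ[ζ] | σ(x) ∈ W}`. -/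
def ASet (W : Set ℂ) : Set ℂ :=
  {x | x ∈ Algebra.adjoin ℤ {zeta8} ∧ ∃ y : Q8, (y : ℂ) = x ∧ ((sigma8 y : Q8) : ℂ) ∈ W}

/-! ### The field `K = ℚ(√2)` -/

theorem sqrt2_isIntegral : IsIntegral ℚ (√2 : ℝ) :=
  ⟨Polynomial.X ^ 2 - Polynomial.C 2, Polynomial.monic_X_pow_sub_C _ (by norm_num), by simp⟩

/-- The real quadratic field `K = ℚ(√2) ⊆ ℝ`. -/
abbrev K : IntermediateField ℚ ℝ := ℚ⟮(√2 : ℝ)⟯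

instance : FiniteDimensional ℚ K :=
  IntermediateField.adjoin.finiteDimensional sqrt2_isIntegral

instance : NumberField K where

/-- `√2` as an element of `K`. -/
def sqrt2 : K := IntermediateField.AdjoinSimple.gen ℚ (√2 : ℝ)

theorem sqrt2_sq : sqrt2 ^ 2 = 2 := by
  apply Subtype.ext
  change (√2 : ℝ) ^ 2 = 2
  norm_num

theorem minpoly_sqrt2 : minpoly ℚ sqrt2 = Polynomial.X ^ 2 - Polynomial.C 2 := by
  symm
  apply minpoly.eq_of_irreducible_of_monic
  · rw [Polynomial.irreducible_iff_roots_eq_zero_of_degree_le_three]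
    · apply Multiset.eq_zero_of_forall_notMem
      intro a ha
      have h := (Polynomial.mem_roots'.mp ha).2
      simp only [Polynomial.IsRoot.def, Polynomial.eval_sub, Polynomial.eval_pow,
        Polynomial.eval_X, Polynomial.eval_C] at h
      refine irrational_sqrt_two ⟨|a|, ?_⟩
      have h2 : (a : ℝ) ^ 2 = 2 := by
        have : a ^ 2 = 2 := by linarith
        exact_mod_cast this
      rw [← h2, Real.sqrt_sq_eq_abs]
      push_cast
      rfl
    · rw [Polynomial.natDegree_X_pow_sub_C]
    · rw [Polynomial.natDegree_X_pow_sub_C]; norm_num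
  · simp [sqrt2_sq]
  · exact Polynomial.monic_X_pow_sub_C _ (by norm_num)

theorem aeval_neg_sqrt2 :
    Polynomial.aeval (-sqrt2)
      (minpoly ℚ (IntermediateField.adjoin.powerBasis sqrt2_isIntegral).gen) = 0 := by
  rw [IntermediateField.adjoin.powerBasis_gen]
  change Polynomial.aeval (-sqrt2) (minpoly ℚ sqrt2) = 0
  rw [minpoly_sqrt2]
  simp [sqrt2_sq]

/-- The non-trivial automorphism `σ` of `K`, determined by `σ(√2) = -√2`. -/
def sigma : K ≃ₐ[ℚ] K :=
  AlgEquiv.ofBijective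
    ((IntermediateField.adjoin.powerBasis sqrt2_isIntegral).lift (-sqrt2) aeval_neg_sqrt2)
    (Algebra.IsAlgebraic.algHom_bijective _)

theorem sigma_sqrt2 : sigma sqrt2 = -sqrt2 :=
  (IntermediateField.adjoin.powerBasis sqrt2_isIntegral).lift_gen _ aeval_neg_sqrt2

/-- The fundamental unit `λ = 1 + √2`. -/
def lam : K := 1 + sqrt2

/-- The norm `N(x) = x σ(x)`, as a real number. -/
def normK (x : K) : ℝ := (x : ℝ) * ((sigma x : K) : ℝ)

/-- The set of primes `π` of `𝓞 K` with `1 < π < λ`. -/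
def primes : Set (𝓞 K) :=
  {p | Prime p ∧ 1 < ((p : K) : ℝ) ∧ ((p : K) : ℝ) < (lam : ℝ)}

theorem finite_small_primes (r : ℝ) :
    {p : 𝓞 K | p ∈ primes ∧ |((sigma (p : K) : K) : ℝ)| ≤ r}.Finite := by
  have hfin := NumberField.Embeddings.finite_of_norm_le K ℂ (max (lam : ℝ) r)
  refine Set.Finite.of_finite_image (f := fun p : 𝓞 K => (p : K)) (hfin.subset ?_)
    (fun a _ b _ h => NumberField.RingOfIntegers.ext h)
  rintro _ ⟨p, ⟨⟨_, h1, h2⟩, h3⟩, rfl⟩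
  refine ⟨p.isIntegral_coe, fun φ => ?_⟩
  have hlift : ∀ ψ : K →ₐ[ℚ] ℂ, ψ sqrt2 = φ sqrt2 → φ (p : K) = ψ (p : K) := by
    intro ψ hψ
    have : φ.toRatAlgHom = ψ := by
      apply (IntermediateField.adjoin.powerBasis sqrt2_isIntegral).algHom_ext
      rw [IntermediateField.adjoin.powerBasis_gen]
      exact hψ.symm
    rw [← this]
    rfl
  let ι : K →ₐ[ℚ] ℂ := (Complex.ofRealHom.comp (algebraMap K ℝ)).toRatAlgHom
  have hι : ∀ x : K, ι x = ((x : ℝ) : ℂ) := fun _ => rfl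
  have hφ : φ sqrt2 ^ 2 = ι sqrt2 ^ 2 := by
    rw [← map_pow, ← map_pow, sqrt2_sq, map_ofNat φ 2, map_ofNat ι 2]
  rcases sq_eq_sq_iff_eq_or_eq_neg.mp hφ with h | h
  · rw [hlift ι h.symm, hι, Complex.norm_real, Real.norm_eq_abs, abs_of_pos (by linarith)]
    exact h2.le.trans (le_max_left _ _)
  · rw [hlift (ι.comp (sigma : K →ₐ[ℚ] K))]
    · change ‖ι (sigma (p : K))‖ ≤ _
      rw [hι, Complex.norm_real, Real.norm_eq_abs]
      exact h3.trans (le_max_right _ _)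
    · change ι (sigma sqrt2) = _
      rw [sigma_sqrt2, map_neg, h]

/-- The finite set `P` of all primes `π` of `𝓞 K` with `1 < π < λ` and `|σ(π)| ≤ r`. -/
def smallPrimes (r : ℝ) : Finset (𝓞 K) := (finite_small_primes r).toFinset

open Classical in
/-- The finite set `M`: the powers `π ^ m_π`, `π ∈ P`, and those elements
`λ ^ k ∏_{π ∈ P} π ^ (e_π)` with `k₀ ≤ k ≤ k₁` and `-m_π < e_π < m_π` that exceed `1`. -/
def quotientSet (r : ℝ) (k₀ k₁ : ℤ) (m : smallPrimes r → ℤ) : Finset K :=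
  Finset.univ.image (fun p : smallPrimes r => ((p : 𝓞 K) : K) ^ m p) ∪
  ((Finset.Icc k₀ k₁ ×ˢ Fintype.piFinset (fun p => Finset.Ioo (-(m p)) (m p))).image
    (fun q : ℤ × (smallPrimes r → ℤ) =>
      lam ^ q.1 * ∏ p : smallPrimes r, ((p : 𝓞 K) : K) ^ q.2 p)).filter
    (fun c => 1 < (c : ℝ))

/-- The set `(ℙ \ P) ∪ M` of real numbers. -/
def candidateSet (r : ℝ) (M : Finset K) : Set ℝ :=
  {c | ∃ p ∈ primes, p ∉ smallPrimes r ∧ c = ((p : K) : ℝ)} ∪ {c | ∃ x ∈ M, c = (x : ℝ)}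

/-- `a` is a numerator of `c`: `c = a / b` for some `b ≠ 0` in `𝓞 K` relatively prime to `a`. -/
def IsNumerator (c : K) (a : 𝓞 K) : Prop :=
  ∃ b : 𝓞 K, b ≠ 0 ∧ IsRelPrime a b ∧ c = (a : K) / (b : K)

/-- `L` is a least common multiple in `𝓞 K` of the numerators of the elements of `S`. -/
def IsLcmOfNumerators (S : Finset K) (L : 𝓞 K) : Prop :=
  ∀ y : 𝓞 K, L ∣ y ↔ ∀ c ∈ S, ∀ a : 𝓞 K, IsNumerator c a → a ∣ y

/-- `W ∩ ⋂_{c ∈ S} σ(c) W`. -/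
def windowInter (W : Set ℂ) (S : Finset K) : Set ℂ :=
  W ∩ ⋂ c ∈ S, ((sigma c : K) : ℝ) • W

end AmmannBeenker

end

open scoped Pointwise Topology NumberField IntermediateField

noncomputable section

namespace AmmannBeenker

/-! ### Arithmetic of `𝓞 K = ℤ[√2]` -/

/-! Write `x ∈ ℤ[ζ]` as `α + βζ` with `α, β ∈ ℤ[√2]`. If a non-zero point of `ℤ[ζ]` is a real
multiple of another, the ratio lies in `K`, so occlusion is arithmetic: for `c = a / b` in lowest
terms, `x / c ∈ A_W` iff `a` divides `α` and `β` and `σ(x) ∈ σ(c) W` (`div_mem_ASet_iff_dvd`). When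
`|σ(c)| ≥ r`, star-shapedness and `-W ⊆ r W` make the window condition automatic for `σ(x) ∈ W`
(`mem_smul_of_le_abs`), so primes outside `P` impose divisibility alone. All this uses that `ℤ[√2]`
is norm-Euclidean, that its positive units are the powers of `λ`, and hence that `ℙ` represents the
primes up to associates.

Existence of `M`: choose `m_π` with `|σ(π)| ^ m_π ≥ r`. Suppose an invisible `x ≠ 0` is divisible by
no prime outside `P` and by no `π ^ m_π`. Among the points of `A_W` occluding it take `q = x / c` of
least modulus; then `q` has no such divisor either (`exists_minimal_quotient`). Comparing greatest
common divisors of coordinates (`exists_content_ratio`) shows that `c` is `λ ^ k` times powers `π ^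
e_π` with `|e_π| < m_π`. The condition `c > 1` bounds `k` below, and since `0 < σ(λ²) < 1`, `k` can
be lowered in steps of two without leaving `A_W`, which bounds it above.

Density: the pairs `(x, σ(x))` form a lattice of covolume 4 in `ℂ²`. Counting tiles, and using
powers of `λ` to balance the two scalings, shows that the multiples `x` of `L` with `x ∈ TD`, `σ(x)
∈ V` number about `vol(TD) vol(V) / (4 N(L)²)`. Inclusion-exclusion over `M` and over a finite set
`Q` of primes outside `P` gives the desired sum times `∏_{q ∈ Q} (1 - N(q)⁻²)`, because the least
common multiples coming from `M` are prime to `Q` (`tendsto_partialVisible`). As `Q` grows, the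
Euler product produces `ζ_K(2)` without its factors at `P`. The limits in `T` and `Q` may be
exchanged because the non-zero multiples of `L` number `O(T² / N(L)²)` uniformly in `L`
(`exists_ncard_multiples_le`), which is summable over primes; that bound rests on `|x| |σ(x)| ≥ 1`
for `x ≠ 0`. -/

/-- The identical embedding of `K` into `ℝ`. -/
def emb₁ : K →+* ℝ := algebraMap K ℝ

/-- The conjugate embedding of `K` into `ℝ`. -/
def emb₂ : K →+* ℝ := (algebraMap K ℝ).comp (sigma : K →+* K)

theorem emb₂_apply (x : K) : emb₂ x = ((sigma x : K) : ℝ) := rfl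

theorem coe_sub (x y : 𝓞 K) : ((x - y : 𝓞 K) : K) = x - y := map_sub _ _ _

theorem coe_neg (x : 𝓞 K) : ((-x : 𝓞 K) : K) = -x := map_neg _ _

theorem coe_mul (x y : 𝓞 K) : ((x * y : 𝓞 K) : K) = x * y := map_mul _ _ _

theorem coe_pow (x : 𝓞 K) (n : ℕ) : ((x ^ n : 𝓞 K) : K) = (x : K) ^ n := map_pow _ _ _

theorem coe_zero : ((0 : 𝓞 K) : K) = 0 := map_zero _

theorem coe_one : ((1 : 𝓞 K) : K) = 1 := map_one _

theorem coe_prod {ι : Type*} (s : Finset ι) (f : ι → 𝓞 K) :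
    ((∏ i ∈ s, f i : 𝓞 K) : K) = ∏ i ∈ s, (f i : K) := map_prod (algebraMap (𝓞 K) K) _ _

theorem normK_eq (x : K) : normK x = emb₁ x * emb₂ x := rfl

theorem normK_mul (x y : K) : normK (x * y) = normK x * normK y := by
  simp only [normK_eq, map_mul]; ring

theorem emb₁_injective : Function.Injective emb₁ := emb₁.injective

theorem emb₁_sqrt2 : emb₁ sqrt2 = √2 := rfl

theorem emb₂_sqrt2 : emb₂ sqrt2 = -√2 := by
  rw [emb₂_apply, sigma_sqrt2]; rfl

theorem emb₁_lam : emb₁ lam = 1 + √2 := rfl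

theorem emb₂_lam : emb₂ lam = 1 - √2 := by
  rw [lam, map_add, map_one, emb₂_sqrt2]; ring

theorem sqrt_two_sq : (√2 : ℝ) ^ 2 = 2 := Real.sq_sqrt (by norm_num)

theorem sqrt_two_gt : (1.414 : ℝ) < √2 := by
  apply Real.lt_sqrt_of_sq_lt; norm_num

theorem sqrt_two_lt : (√2 : ℝ) < 1.415 := by
  rw [Real.sqrt_lt' (by norm_num)]; norm_num

theorem exists_rat_repr (x : K) : ∃ a b : ℚ, x = (a : K) + (b : K) * sqrt2 := by
  obtain ⟨f, hf, rfl⟩ :=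
    (IntermediateField.adjoin.powerBasis sqrt2_isIntegral).exists_eq_aeval x
  have hdim : (IntermediateField.adjoin.powerBasis sqrt2_isIntegral).dim = 2 := by
    rw [← PowerBasis.natDegree_minpoly, IntermediateField.adjoin.powerBasis_gen]
    change (minpoly ℚ sqrt2).natDegree = 2
    rw [minpoly_sqrt2, Polynomial.natDegree_X_pow_sub_C]
  rw [hdim] at hf
  obtain ⟨a, b, rfl⟩ := Polynomial.exists_eq_X_add_C_of_natDegree_le_one
    (show f.natDegree ≤ 1 by omega)
  refine ⟨b, a, ?_⟩
  rw [IntermediateField.adjoin.powerBasis_gen]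
  change Polynomial.aeval sqrt2 _ = _
  simp [add_comm]

theorem exists_int_of_isIntegral_rat {q : ℚ} (h : IsIntegral ℤ (q : K)) : ∃ n : ℤ, q = n := by
  have : IsIntegral ℤ q := by
    rwa [← isIntegral_algebraMap_iff (algebraMap ℚ K).injective (A := ℚ)]
  obtain ⟨n, hn⟩ := IsIntegrallyClosed.isIntegral_iff.mp this
  exact ⟨n, hn.symm⟩

theorem isIntegral_sqrt2 : IsIntegral ℤ sqrt2 :=
  ⟨Polynomial.X ^ 2 - Polynomial.C 2, Polynomial.monic_X_pow_sub_C _ (by norm_num), by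
    simp [sqrt2_sq]⟩

/-- `√2` as an algebraic integer. -/
def sqrt2Int : 𝓞 K := ⟨sqrt2, isIntegral_sqrt2⟩

theorem coe_sqrt2Int : (sqrt2Int : K) = sqrt2 := rfl

/-- For `x = p + q√2`, the trace, `√2 (x - σ(x))` and the norm are rational and integral, so `2p`,
`4q` and `p² - 2q²` are integers; a parity descent removes the denominators. -/
theorem exists_int_repr (x : 𝓞 K) : ∃ a b : ℤ, x = (a : 𝓞 K) + (b : 𝓞 K) * sqrt2Int := by
  obtain ⟨p, q, h⟩ := exists_rat_repr (x : K)
  have hx : IsIntegral ℤ (x : K) := x.isIntegral_coe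
  have hsx : IsIntegral ℤ (sigma (x : K)) := hx.map (sigma.toAlgHom.restrictScalars ℤ)
  have hs : sigma (x : K) = (p : K) - (q : K) * sqrt2 := by
    rw [h, map_add, map_mul, map_ratCast, map_ratCast, sigma_sqrt2]; ring
  have h2 := sqrt2_sq
  obtain ⟨A, hA⟩ : ∃ n : ℤ, 2 * p = n := by
    apply exists_int_of_isIntegral_rat
    have := hx.add hsx
    rw [hs, h] at this
    rwa [show ((2 * p : ℚ) : K) = p + q * sqrt2 + (p - q * sqrt2) by push_cast; ring]
  obtain ⟨C, hC⟩ : ∃ n : ℤ, 4 * q = n := by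
    apply exists_int_of_isIntegral_rat
    have := isIntegral_sqrt2.mul (hx.sub hsx)
    rw [hs, h] at this
    rwa [show ((4 * q : ℚ) : K) = sqrt2 * (p + q * sqrt2 - (p - q * sqrt2)) by
      push_cast; linear_combination (-2 * (q : K)) * h2]
  obtain ⟨D, hD⟩ : ∃ n : ℤ, p ^ 2 - 2 * q ^ 2 = n := by
    apply exists_int_of_isIntegral_rat
    have := hx.mul hsx
    rw [hs, h] at this
    rwa [show ((p ^ 2 - 2 * q ^ 2 : ℚ) : K) = (p + q * sqrt2) * (p - q * sqrt2) by
      push_cast; linear_combination ((q : K) ^ 2) * h2]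
  -- This relation forces in turn `C`, `A` and `C / 2` to be even.
  have e : 2 * A ^ 2 - C ^ 2 = 8 * D := by
    have : (2 * A ^ 2 - C ^ 2 : ℚ) = 8 * D := by rw [← hA, ← hC, ← hD]; ring
    exact_mod_cast this
  have hCe : Even C := by
    have : Even (C ^ 2) := ⟨A ^ 2 - 4 * D, by linarith⟩
    exact (Int.even_pow.mp this).1
  obtain ⟨C', rfl⟩ := hCe
  have hAe : Even A := by
    have : Even (A ^ 2) := ⟨C' ^ 2 + 2 * D, by linarith⟩
    exact (Int.even_pow.mp this).1
  obtain ⟨A', rfl⟩ := hAe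
  have hCe' : Even C' := by
    have : Even (C' ^ 2) := ⟨A' ^ 2 - D, by linarith⟩
    exact (Int.even_pow.mp this).1
  obtain ⟨C'', rfl⟩ := hCe'
  refine ⟨A', C'', ?_⟩
  apply NumberField.RingOfIntegers.ext
  have hp : p = A' := by push_cast at hA; linarith
  have hq : q = C'' := by push_cast at hC; linarith
  rw [h, hp, hq]
  simp [coe_sqrt2Int]

theorem emb₁_int_repr (a b : ℤ) :
    emb₁ (((a : 𝓞 K) + (b : 𝓞 K) * sqrt2Int : 𝓞 K) : K) = a + b * √2 := by
  simp [coe_sqrt2Int, emb₁_sqrt2]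

theorem emb₂_int_repr (a b : ℤ) :
    emb₂ (((a : 𝓞 K) + (b : 𝓞 K) * sqrt2Int : 𝓞 K) : K) = a - b * √2 := by
  simp [coe_sqrt2Int, emb₂_sqrt2, sub_eq_add_neg]

theorem exists_emb_repr (x : 𝓞 K) :
    ∃ a b : ℤ, emb₁ (x : K) = a + b * √2 ∧ emb₂ (x : K) = a - b * √2 := by
  obtain ⟨a, b, rfl⟩ := exists_int_repr x
  exact ⟨a, b, emb₁_int_repr a b, emb₂_int_repr a b⟩

theorem exists_int_normK (x : 𝓞 K) : ∃ n : ℤ, normK (x : K) = n := by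
  obtain ⟨a, b, h₁, h₂⟩ := exists_emb_repr x
  refine ⟨a ^ 2 - 2 * b ^ 2, ?_⟩
  rw [normK_eq, h₁, h₂]
  push_cast
  linear_combination (-(b : ℝ) ^ 2) * sqrt_two_sq

theorem normK_ne_zero {x : K} (hx : x ≠ 0) : normK x ≠ 0 :=
  mul_ne_zero ((map_ne_zero emb₁).mpr hx) ((map_ne_zero emb₂).mpr hx)

theorem coe_ne_zero {x : 𝓞 K} (hx : x ≠ 0) : (x : K) ≠ 0 :=
  fun h => hx (NumberField.RingOfIntegers.ext h)

theorem one_le_abs_normK {x : 𝓞 K} (hx : x ≠ 0) : 1 ≤ |normK (x : K)| := by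
  obtain ⟨n, hn⟩ := exists_int_normK x
  have h0 := normK_ne_zero (coe_ne_zero hx)
  rw [hn] at h0 ⊢
  have : n ≠ 0 := by exact_mod_cast h0
  exact_mod_cast Int.one_le_abs this

/-- The conjugate of an algebraic integer. -/
def conjInt (x : 𝓞 K) : 𝓞 K :=
  ⟨sigma (x : K), x.isIntegral_coe.map (sigma.toAlgHom.restrictScalars ℤ)⟩

theorem isUnit_iff_abs_normK {x : 𝓞 K} : IsUnit x ↔ |normK (x : K)| = 1 := by
  constructor
  · rintro hx
    obtain ⟨y, hy⟩ := hx.exists_right_inv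
    have hx0 : x ≠ 0 := left_ne_zero_of_mul_eq_one hy
    have hy0 : y ≠ 0 := right_ne_zero_of_mul_eq_one hy
    have h : normK (x : K) * normK (y : K) = 1 := by
      rw [← normK_mul, ← coe_mul, hy]; simp [normK_eq]
    have h1 := one_le_abs_normK hx0
    have h2 := one_le_abs_normK hy0
    have h3 : |normK (x : K)| * |normK (y : K)| = 1 := by rw [← abs_mul, h, abs_one]
    nlinarith
  · intro h
    have hmul : emb₁ ((x * conjInt x : 𝓞 K) : K) = normK (x : K) := by
      rw [coe_mul, map_mul, normK_eq]; rfl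
    rcases abs_eq (zero_le_one) |>.mp h with h | h
    · refine IsUnit.of_mul_eq_one (conjInt x) ?_
      apply NumberField.RingOfIntegers.ext
      apply emb₁_injective
      rw [hmul, h]; simp
    · refine IsUnit.of_mul_eq_one (-conjInt x) ?_
      apply NumberField.RingOfIntegers.ext
      apply emb₁_injective
      rw [mul_neg, coe_neg, map_neg, hmul, h]; simp

/-- An algebraic integer strictly between `1` and `λ` has a conjugate outside `[-1, 1]`. -/
theorem one_lt_abs_emb₂ {x : 𝓞 K} (h1 : 1 < emb₁ (x : K)) (h2 : emb₁ (x : K) < emb₁ lam) :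
    1 < |emb₂ (x : K)| := by
  by_contra! h
  obtain ⟨a, b, ha, hb⟩ := exists_emb_repr x
  rw [emb₁_lam] at h2
  rw [ha] at h1 h2
  rw [hb, abs_le] at h
  obtain ⟨h3, h4⟩ := h
  have s1 := sqrt_two_gt
  have s2 := sqrt_two_lt
  -- The two embeddings add up to `2a`, which lies in `(0, 2 + √2)`; so `a = 1`. Then only `b = 1`
  -- is left, and `x` would be `λ` itself.
  have a1 : a = 1 := by
    have l : (0 : ℝ) < a := by linarith
    have u : (a : ℝ) < 2 := by linarith
    have l' : 0 < a := by exact_mod_cast l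
    have u' : a < 2 := by exact_mod_cast u
    omega
  have b1 : b = 1 := by
    have l : (0 : ℝ) < b := by nlinarith
    have u : (b : ℝ) < 2 := by nlinarith
    have l' : 0 < b := by exact_mod_cast l
    have u' : b < 2 := by exact_mod_cast u
    omega
  rw [a1, b1] at h2
  norm_num at h2

theorem one_lt_emb₁_lam : 1 < emb₁ lam := by
  rw [emb₁_lam]; linarith [sqrt_two_gt]

theorem lam_ne_zero : lam ≠ 0 := by
  intro h
  have := one_lt_emb₁_lam
  rw [h, map_zero] at this
  linarith

theorem isIntegral_lam : IsIntegral ℤ lam := isIntegral_one.add isIntegral_sqrt2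

theorem emb_lam_mul : emb₁ lam * emb₂ lam = -1 := by
  rw [emb₁_lam, emb₂_lam]; linear_combination -sqrt_two_sq

theorem exists_unit_lam : ∃ u : (𝓞 K)ˣ, ((u : 𝓞 K) : K) = lam := by
  obtain ⟨x, hx⟩ : ∃ x : 𝓞 K, (x : K) = lam := ⟨⟨lam, isIntegral_lam⟩, rfl⟩
  have : IsUnit x := by
    rw [isUnit_iff_abs_normK, normK_eq, hx, emb_lam_mul]; simp
  exact ⟨this.unit, hx⟩

/-- The fundamental unit as a unit of `𝓞 K`. -/
def lamUnit : (𝓞 K)ˣ := exists_unit_lam.choose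

theorem coe_lamUnit : ((lamUnit : 𝓞 K) : K) = lam := exists_unit_lam.choose_spec

theorem coe_lamUnit_zpow (k : ℤ) : (((lamUnit ^ k : (𝓞 K)ˣ) : 𝓞 K) : K) = lam ^ k := by
  have h : ∀ u : (𝓞 K)ˣ, ((u : 𝓞 K) : K) =
    ((Units.map (algebraMap (𝓞 K) K : 𝓞 K →* K) u : Kˣ) : K) := fun _ => rfl
  rw [h, map_zpow, Units.val_zpow_eq_zpow_val, ← h, coe_lamUnit]

/-- A unit strictly between `1` and `λ` would have a conjugate of modulus less than 1, against
`one_lt_abs_emb₂`. So `λ` is the fundamental unit. -/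
theorem eq_one_of_unit {u : (𝓞 K)ˣ} (h1 : 1 ≤ emb₁ ((u : 𝓞 K) : K))
    (h2 : emb₁ ((u : 𝓞 K) : K) < emb₁ lam) : (u : 𝓞 K) = 1 := by
  rcases h1.eq_or_lt with h | h
  · apply NumberField.RingOfIntegers.ext
    apply emb₁_injective
    rw [← h]; simp
  · have h3 := one_lt_abs_emb₂ h h2
    have h4 := isUnit_iff_abs_normK.mp u.isUnit
    rw [normK_eq, abs_mul, abs_of_pos (by linarith)] at h4
    nlinarith

theorem exists_lam_zpow_mul {x : K} (hx : 0 < emb₁ x) :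
    ∃ k : ℤ, 1 ≤ emb₁ (lam ^ k * x) ∧ emb₁ (lam ^ k * x) < emb₁ lam := by
  obtain ⟨n, h1, h2⟩ := exists_mem_Ico_zpow hx one_lt_emb₁_lam
  have hl : (0 : ℝ) < emb₁ lam := by linarith [one_lt_emb₁_lam]
  refine ⟨-n, ?_, ?_⟩
  · rw [map_mul, map_zpow₀, zpow_neg, ← div_eq_inv_mul, one_le_div (zpow_pos hl _)]
    exact h1
  · rw [map_mul, map_zpow₀, zpow_neg, ← div_eq_inv_mul, div_lt_iff₀ (zpow_pos hl _)]
    rwa [zpow_add_one₀ hl.ne', mul_comm] at h2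

theorem unit_eq_lam_zpow {u : (𝓞 K)ˣ} (hu : 0 < emb₁ ((u : 𝓞 K) : K)) :
    ∃ k : ℤ, ((u : 𝓞 K) : K) = lam ^ k := by
  obtain ⟨k, h1, h2⟩ := exists_lam_zpow_mul hu
  have h := @eq_one_of_unit (lamUnit ^ k * u)
  rw [Units.val_mul, coe_mul, coe_lamUnit_zpow] at h
  have h3 := congrArg (fun x : 𝓞 K => (x : K)) (h h1 h2)
  simp only [coe_mul, coe_lamUnit_zpow, coe_one] at h3
  refine ⟨-k, ?_⟩
  rw [zpow_neg]
  exact eq_inv_of_mul_eq_one_right h3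

theorem mem_primes {p : 𝓞 K} :
    p ∈ primes ↔ Prime p ∧ 1 < emb₁ (p : K) ∧ emb₁ (p : K) < emb₁ lam := Iff.rfl

theorem primes_pos {p : 𝓞 K} (hp : p ∈ primes) : 0 < emb₁ (p : K) := by
  have := (mem_primes.mp hp).2.1
  linarith

/-- A sign and a power of `λ` move any prime into `[1, λ)`, and `1` is not prime. With
`primes_eq_of_associated`, this makes `primes` a system of representatives for the primes up to
units. -/
theorem exists_mem_primes_associated {q : 𝓞 K} (hq : Prime q) :
    ∃ p ∈ primes, Associated p q := by
  wlog hpos : 0 < emb₁ (q : K) generalizing q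
  · have hne : emb₁ (q : K) ≠ 0 := (map_ne_zero emb₁).mpr (coe_ne_zero hq.ne_zero)
    obtain ⟨p, hp, ha⟩ := this hq.neg (by
      rw [coe_neg, map_neg]
      have := lt_of_le_of_ne (not_lt.mp hpos) hne
      linarith)
    exact ⟨p, hp, ha.trans (Associated.neg_left (Associated.refl q))⟩
  obtain ⟨k, h1, h2⟩ := exists_lam_zpow_mul hpos
  have has : Associated ((lamUnit ^ k : (𝓞 K)ˣ) * q : 𝓞 K) q :=
    associated_unit_mul_left q _ (lamUnit ^ k).isUnit
  have hprime : Prime ((lamUnit ^ k : (𝓞 K)ˣ) * q : 𝓞 K) := has.symm.prime hq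
  have hc : (((lamUnit ^ k : (𝓞 K)ˣ) * q : 𝓞 K) : K) = lam ^ k * q := by
    rw [coe_mul, coe_lamUnit_zpow]
  refine ⟨_, mem_primes.mpr ⟨hprime, ?_, ?_⟩, has⟩
  · rw [hc]
    refine lt_of_le_of_ne h1 fun h => hprime.not_isUnit ?_
    have : ((lamUnit ^ k : (𝓞 K)ˣ) * q : 𝓞 K) = 1 := by
      apply NumberField.RingOfIntegers.ext
      apply emb₁_injective
      rw [hc, ← h]; simp
    rw [this]
    exact isUnit_one
  · rwa [hc]

theorem primes_eq_of_associated {p q : 𝓞 K} (hp : p ∈ primes) (hq : q ∈ primes)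
    (h : Associated p q) : p = q := by
  wlog hle : emb₁ (p : K) ≤ emb₁ (q : K) generalizing p q
  · exact (this hq hp h.symm (le_of_not_ge hle)).symm
  obtain ⟨u, hu⟩ := h
  have e : emb₁ (p : K) * emb₁ ((u : 𝓞 K) : K) = emb₁ (q : K) := by
    rw [← map_mul, ← coe_mul, hu]
  rw [mem_primes] at hp hq
  have h1 : (u : 𝓞 K) = 1 := eq_one_of_unit (by nlinarith) (by nlinarith)
  rw [← hu, h1, mul_one]

/-- Rounding both coordinates of `x / y` leaves `s + t√2` with `|s|, |t| ≤ 1/2`, and then `|s² -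
2t²| ≤ 1/2`. This is Euclidean division for the norm. -/
theorem exists_abs_normK_sub_mul_lt (x : 𝓞 K) {y : 𝓞 K} (hy : y ≠ 0) :
    ∃ q : 𝓞 K, |normK ((x - y * q : 𝓞 K) : K)| < |normK (y : K)| := by
  obtain ⟨p, q, h⟩ := exists_rat_repr ((x : K) / (y : K))
  have hy' := coe_ne_zero hy
  set z : 𝓞 K := (round p : 𝓞 K) + (round q : 𝓞 K) * sqrt2Int with hz
  refine ⟨z, ?_⟩
  have e : ((x - y * z : 𝓞 K) : K) =
      (y : K) * (((p - round p : ℚ) : K) + ((q - round q : ℚ) : K) * sqrt2) := by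
    have : (x : K) = (y : K) * ((p : K) + (q : K) * sqrt2) := by
      rw [← h, mul_div_cancel₀ _ hy']
    rw [coe_sub, coe_mul, this, hz, ← coe_sqrt2Int]
    push_cast
    simp only [map_intCast]
    ring
  rw [e, normK_mul, abs_mul]
  have hpos : 0 < |normK (y : K)| := abs_pos.mpr (normK_ne_zero hy')
  have hlt : |normK (((p - round p : ℚ) : K) + ((q - round q : ℚ) : K) * sqrt2)| < 1 := by
    have hp := abs_sub_round p
    have hq := abs_sub_round q
    generalize p - round p = s at hp ⊢
    generalize q - round q = t at hq ⊢
    have : normK ((s : K) + (t : K) * sqrt2) = ((s ^ 2 - 2 * t ^ 2 : ℚ) : ℝ) := by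
      rw [normK_eq, map_add, map_mul, map_add, map_mul, emb₁_sqrt2, emb₂_sqrt2]
      simp only [map_ratCast]
      push_cast
      linear_combination (-(t : ℝ) ^ 2) * sqrt_two_sq
    rw [this]
    have : |s ^ 2 - 2 * t ^ 2| < 1 := by
      rw [abs_le] at hp hq
      rw [abs_lt]
      constructor <;> nlinarith
    exact_mod_cast this
  nlinarith

instance isPrincipalIdealRing_ringOfIntegers : IsPrincipalIdealRing (𝓞 K) := by
  classical
  refine ⟨fun I => ?_⟩
  by_cases hI : I = ⊥
  · rw [hI]; exact bot_isPrincipal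
  obtain ⟨y₀, hy₀, hy₀'⟩ := Submodule.exists_mem_ne_zero_of_ne_bot hI
  choose N hN using exists_int_normK
  have hex : ∃ n : ℕ, ∃ y ∈ I, y ≠ 0 ∧ (N y).natAbs = n := ⟨_, y₀, hy₀, hy₀', rfl⟩
  obtain ⟨y, hyI, hy0, hyn⟩ := Nat.find_spec hex
  refine ⟨⟨y, le_antisymm (fun x hx => ?_) ?_⟩⟩
  · obtain ⟨q, hq⟩ := exists_abs_normK_sub_mul_lt x hy0
    rw [hN, hN] at hq
    have hq' : (N (x - y * q)).natAbs < (N y).natAbs := by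
      zify; exact_mod_cast hq
    have hmem : x - y * q ∈ I := I.sub_mem hx (I.mul_mem_right _ hyI)
    have : x - y * q = 0 := by
      by_contra hne
      rw [hyn] at hq'
      exact Nat.find_min hex hq' ⟨_, hmem, hne, rfl⟩
    rw [sub_eq_zero.mp this]
    exact Ideal.mem_span_singleton'.mpr ⟨q, mul_comm _ _⟩
  · exact (Ideal.span_singleton_le_iff_mem I).mpr hyI

/-- The field norm is invariant under `σ` and sends a rational `q` to `q²`; applied to `q = x σ(x)`
this identifies `normK` with the field norm up to sign, and only squares are needed. -/
theorem normK_sq_eq (x : 𝓞 K) :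
    normK (x : K) ^ 2 = (Ideal.absNorm (Ideal.span {x}) : ℝ) ^ 2 := by
  have hq : ∃ q : ℚ, (x : K) * sigma (x : K) = algebraMap ℚ K q := by
    obtain ⟨a, b, rfl⟩ := exists_int_repr x
    refine ⟨a ^ 2 - 2 * b ^ 2, ?_⟩
    have h2 := sqrt2_sq
    simp only [map_add, map_mul, map_intCast, coe_sqrt2Int, sigma_sqrt2, map_sub, map_pow,
      map_ofNat]
    linear_combination (-(b : K) ^ 2) * h2
  obtain ⟨q, hq⟩ := hq
  have hfin : Module.finrank ℚ K = 2 := by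
    have : (minpoly ℚ sqrt2).natDegree = 2 := by
      rw [minpoly_sqrt2, Polynomial.natDegree_X_pow_sub_C]
    rw [IntermediateField.adjoin.finrank sqrt2_isIntegral, ← this]
    congr 1
    exact minpoly.algebraMap_eq (algebraMap K ℝ).injective sqrt2
  have h1 : Algebra.norm ℚ (x : K) ^ 2 = q ^ 2 := by
    have := congrArg (Algebra.norm ℚ) hq
    rw [map_mul, Algebra.norm_algebraMap, hfin, Algebra.norm_eq_of_algEquiv] at this
    rw [← this, sq]
  have h2 : normK (x : K) = q := by
    rw [normK, ← IntermediateField.coe_mul, hq]; simp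
  rw [h2, Ideal.absNorm_span_singleton, Nat.cast_natAbs, Int.cast_abs, sq_abs]
  have h3 := Algebra.coe_norm_int x
  have h4 : ((Algebra.norm ℤ x : ℤ) : ℚ) ^ 2 = q ^ 2 := by rw [h3, h1]
  exact_mod_cast h4.symm

/-! ### The Dedekind zeta value `ζ_K(2)` and its Euler product -/

-- The number of ideals of norm at most `n` grows linearly, so the Dirichlet series converges
-- absolutely beyond exponent 1.
open Filter Ideal in
theorem summable_card_absNorm_eq (F : Type*) [Field F] [NumberField F] :
    LSeriesSummable (fun n ↦ (Nat.card {I : Ideal (𝓞 F) // absNorm I = n} : ℂ)) 2 := by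
  have h : LSeriesSummable
      (fun n ↦ (((Nat.card {I : Ideal (𝓞 F) // absNorm I = n} : ℝ)) : ℂ)) 2 := by
    refine LSeriesSummable_of_sum_norm_bigO_and_nonneg (r := 1) ?_
      (fun _ ↦ Nat.cast_nonneg _) zero_le_one (by norm_num)
    refine Asymptotics.isBigO_of_div_tendsto_nhds (c := NumberField.dedekindZeta_residue F) ?_ ?_
    · filter_upwards [eventually_gt_atTop 0] with n hn h0
      have : (0 : ℝ) < n := by exact_mod_cast hn
      rw [Real.rpow_one] at h0
      linarith
    refine ((NumberField.Ideal.tendsto_norm_le_div_atTop₀ F).comp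
      tendsto_natCast_atTop_atTop).congr fun n ↦ ?_
    simp only [Function.comp_apply, Nat.cast_le, ← Nat.cast_sum, Pi.div_apply, Real.rpow_one]
    congr
    -- The added 1 accounts for the zero ideal, the only one of norm 0, which the cited limit leaves
    -- out.
    rw [← add_left_inj 1, ← card_norm_le_eq_card_norm_le_add_one,
      show Finset.Icc 1 n = Finset.Ioc 0 n from Finset.Icc_succ_left_eq_Ioc _ _,
      show 1 = Nat.card {I : Ideal (𝓞 F) // absNorm I = 0} by simp [Ideal.absNorm_eq_zero_iff],
      Finset.sum_Ioc_add_eq_sum_Icc (n.zero_le),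
      ← Finset.card_preimage_eq_sum_card_image_eq (fun k _ ↦ finite_setOfPred_absNorm_eq k)]
    simp [Set.coe_eq_subtype]
  simpa using h

theorem hasSum_absNorm_inv_sq (F : Type*) [Field F] [NumberField F] :
    HasSum (fun I : Ideal (𝓞 F) => ((Ideal.absNorm I : ℝ) ^ 2)⁻¹)
      (NumberField.dedekindZeta F 2).re := by
  set c : ℕ → ℝ := fun n => Nat.card {I : Ideal (𝓞 F) // Ideal.absNorm I = n} with hc
  have hterm : ∀ n : ℕ,
      (LSeries.term (fun n ↦ (Nat.card {I : Ideal (𝓞 F) // Ideal.absNorm I = n} : ℂ)) 2 n).re =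
        c n * ((n : ℝ) ^ 2)⁻¹ := by
    intro n
    rw [LSeries.term_def]
    split_ifs with h
    -- At `n = 0` the L-series term is 0 by convention and the other side is 0 because `0⁻¹ = 0`, so
    -- the zero ideal is harmless.
    · simp [h]
    · have : ((Nat.card {I : Ideal (𝓞 F) // Ideal.absNorm I = n} : ℂ) / (n : ℂ) ^ (2 : ℂ)) =
          ((c n * ((n : ℝ) ^ 2)⁻¹ : ℝ) : ℂ) := by
        rw [Complex.cpow_ofNat, hc]
        push_cast
        rw [div_eq_mul_inv]
      rw [this, Complex.ofReal_re]
  have hS := Complex.hasSum_re (summable_card_absNorm_eq F).hasSum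
  simp only [hterm] at hS
  rw [← (Equiv.sigmaFiberEquiv (fun I : Ideal (𝓞 F) => Ideal.absNorm I)).hasSum_iff]
  have hfin : ∀ n, Finite {I : Ideal (𝓞 F) // Ideal.absNorm I = n} := fun n =>
    (Ideal.finite_setOfPred_absNorm_eq n).to_subtype
  have hval : ∀ n : ℕ, ∀ I : {I : Ideal (𝓞 F) // Ideal.absNorm I = n},
      ((fun I : Ideal (𝓞 F) => ((Ideal.absNorm I : ℝ) ^ 2)⁻¹) ∘
        (Equiv.sigmaFiberEquiv (fun I : Ideal (𝓞 F) => Ideal.absNorm I))) ⟨n, I⟩ =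
        ((n : ℝ) ^ 2)⁻¹ := by
    rintro n ⟨I, hI⟩
    simp [Equiv.sigmaFiberEquiv, hI]
  have htsum : ∀ n : ℕ, ∑' I : {I : Ideal (𝓞 F) // Ideal.absNorm I = n},
      ((fun I : Ideal (𝓞 F) => ((Ideal.absNorm I : ℝ) ^ 2)⁻¹) ∘
        (Equiv.sigmaFiberEquiv (fun I : Ideal (𝓞 F) => Ideal.absNorm I))) ⟨n, I⟩ =
        c n * ((n : ℝ) ^ 2)⁻¹ := by
    intro n
    simp_rw [hval]
    rw [tsum_const, nsmul_eq_mul]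
  have hsum : Summable ((fun I : Ideal (𝓞 F) => ((Ideal.absNorm I : ℝ) ^ 2)⁻¹) ∘
      (Equiv.sigmaFiberEquiv (fun I : Ideal (𝓞 F) => Ideal.absNorm I))) := by
    rw [summable_sigma_of_nonneg (fun x => by simp only [Function.comp_apply]; positivity)]
    refine ⟨fun n => ?_, ?_⟩
    · exact Summable.of_finite
    · simp only [htsum]
      exact hS.summable
  convert hsum.hasSum using 1
  rw [hsum.tsum_sigma]
  simp only [htsum]
  exact hS.tsum_eq.symm

/-- The ideals of `𝓞 K` that are not divisible by any prime of a given finite set. -/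
def coprimeIdeals (Q : Finset primes) : Set (Ideal (𝓞 K)) :=
  {I | ∀ p ∈ Q, ¬ Ideal.span {(p : 𝓞 K)} ∣ I}

theorem prime_span (p : primes) : Prime (Ideal.span {(p : 𝓞 K)}) :=
  (Ideal.prime_span_singleton_iff).mpr p.2.1

theorem span_primes_injective : Function.Injective fun p : primes => Ideal.span {(p : 𝓞 K)} :=
  fun p q h => Subtype.ext (primes_eq_of_associated p.2 q.2
    (Ideal.span_singleton_eq_span_singleton.mp h))

theorem span_mul_mem_coprimeIdeals {Q : Finset primes} {p : primes} (hp : p ∉ Q)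
    (J : Ideal (𝓞 K)) :
    Ideal.span {(p : 𝓞 K)} * J ∈ coprimeIdeals Q ↔ J ∈ coprimeIdeals Q := by
  refine forall₂_congr fun q hq => not_congr ⟨fun h => ?_, fun h => h.mul_left _⟩
  refine ((prime_span q).dvd_or_dvd h).resolve_left fun h' => hp ?_
  have := (prime_span q).associated_of_dvd (prime_span p) h'
  rwa [span_primes_injective (associated_iff_eq.mp this)] at hq

-- Sieving by one more prime `p` removes the ideals `pJ` with `J` in the previous set, that is, the
-- fraction `N(p)⁻²` of the sum. Repeating this gives the finite Euler factors.
open Classical in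
theorem tsum_coprimeIdeals (Q : Finset primes) :
    ∑' I, (coprimeIdeals Q).indicator (fun I => ((Ideal.absNorm I : ℝ) ^ 2)⁻¹) I =
      (∏ p ∈ Q, (1 - 1 / normK ((p : 𝓞 K) : K) ^ 2)) * (NumberField.dedekindZeta K 2).re := by
  have hsum := hasSum_absNorm_inv_sq K
  set f : Ideal (𝓞 K) → ℝ := fun I => ((Ideal.absNorm I : ℝ) ^ 2)⁻¹ with hf
  induction Q using Finset.induction_on with
  | empty =>
    have : coprimeIdeals ∅ = Set.univ := by ext; simp [coprimeIdeals]
    rw [this, Set.indicator_univ, hsum.tsum_eq]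
    simp
  | insert p Q hp ih =>
    rw [Finset.prod_insert hp, mul_assoc, ← ih]
    have hs := hsum.summable
    set A := coprimeIdeals Q
    set B := {I : Ideal (𝓞 K) | Ideal.span {(p : 𝓞 K)} ∣ I}
    have h1 : ∀ I, A.indicator f I =
        (coprimeIdeals (insert p Q)).indicator f I + (A ∩ B).indicator f I := by
      intro I
      by_cases hA : I ∈ A <;> by_cases hB : I ∈ B
      · have : I ∉ coprimeIdeals (insert p Q) := fun h => h p (Finset.mem_insert_self _ _) hB
        simp [hA, hB, this]
      · have : I ∈ coprimeIdeals (insert p Q) := by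
          intro q hq
          rcases Finset.mem_insert.mp hq with rfl | hq
          · exact hB
          · exact hA q hq
        simp [hA, hB, this]
      · have : I ∉ coprimeIdeals (insert p Q) := fun h => h p (Finset.mem_insert_self _ _) hB
        simp [hA, this]
      · have : I ∉ coprimeIdeals (insert p Q) :=
          fun h => hA fun q hq => h q (Finset.mem_insert_of_mem hq)
        simp [hA, this]
    have h2 : ∑' I, A.indicator f I = ∑' I, (coprimeIdeals (insert p Q)).indicator f I +
        ∑' I, (A ∩ B).indicator f I := by
      rw [← (hs.indicator _).tsum_add (hs.indicator _)]
      exact tsum_congr h1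
    have hinj : Function.Injective fun J => Ideal.span {(p : 𝓞 K)} * J :=
      mul_right_injective₀ (prime_span p).ne_zero
    have h3 : ∑' I, (A ∩ B).indicator f I =
        1 / normK ((p : 𝓞 K) : K) ^ 2 * ∑' I, A.indicator f I := by
      rw [← hinj.tsum_eq (f := (A ∩ B).indicator f), ← tsum_mul_left]
      · refine tsum_congr fun J => ?_
        have hB : Ideal.span {(p : 𝓞 K)} * J ∈ B := dvd_mul_right _ _
        have hfm : f (Ideal.span {(p : 𝓞 K)} * J) = 1 / normK ((p : 𝓞 K) : K) ^ 2 * f J := by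
          simp only [hf]
          rw [map_mul, normK_sq_eq, Nat.cast_mul, mul_pow, mul_inv, one_div]
        by_cases hJ : J ∈ A
        · rw [Set.indicator_of_mem (s := A ∩ B)
            ⟨(span_mul_mem_coprimeIdeals hp J).mpr hJ, hB⟩,
            Set.indicator_of_mem hJ, hfm]
        · rw [Set.indicator_of_notMem
            (fun h => hJ ((span_mul_mem_coprimeIdeals hp J).mp h.1)),
            Set.indicator_of_notMem hJ, mul_zero]
      · intro I hI
        obtain ⟨J, hJ⟩ : I ∈ B := (Set.mem_of_indicator_ne_zero hI).2
        exact ⟨J, hJ.symm⟩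
    rw [h3] at h2
    linear_combination -h2

theorem exists_primes_dvd {I : Ideal (𝓞 K)} (h0 : I ≠ ⊥) (h1 : I ≠ ⊤) :
    ∃ p : primes, Ideal.span {(p : 𝓞 K)} ∣ I := by
  obtain ⟨a, rfl⟩ := IsPrincipalIdealRing.principal I |>.principal
  rw [Ideal.submodule_span_eq] at *
  have ha0 : a ≠ 0 := fun h => h0 (by simp [h])
  have ha1 : ¬ IsUnit a := fun h => h1 (Ideal.span_singleton_eq_top.mpr h)
  obtain ⟨q, hq, hqa⟩ := WfDvdMonoid.exists_irreducible_factor ha1 ha0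
  obtain ⟨p, hp, hpq⟩ := exists_mem_primes_associated hq.prime
  refine ⟨⟨p, hp⟩, ?_⟩
  rw [Ideal.dvd_span_singleton, Ideal.mem_span_singleton]
  exact hpq.dvd.trans hqa

/-- Dominated convergence: an ideal other than `⊤` and `⊥` drops out once `Q` contains one of its
prime divisors, `⊥` has weight 0, and `⊤` has weight 1. -/
theorem tendsto_tsum_coprimeIdeals :
    Filter.Tendsto (fun Q : Finset primes =>
      ∑' I, (coprimeIdeals Q).indicator (fun I => ((Ideal.absNorm I : ℝ) ^ 2)⁻¹) I)
      Filter.atTop (𝓝 1) := by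
  classical
  have hs := (hasSum_absNorm_inv_sq K).summable
  set f : Ideal (𝓞 K) → ℝ := fun I => ((Ideal.absNorm I : ℝ) ^ 2)⁻¹ with hf
  have hlim : ∑' I, ({⊤} : Set (Ideal (𝓞 K))).indicator f I = 1 := by
    rw [tsum_eq_single ⊤ (fun I hI => Set.indicator_of_notMem (s := {⊤}) hI _)]
    simp [hf]
  rw [← hlim]
  refine tendsto_tsum_of_dominated_convergence hs (fun I => ?_) (Filter.Eventually.of_forall
    fun Q I => ?_)
  · by_cases h1 : I = ⊤
    · subst h1
      refine tendsto_const_nhds.congr fun Q => ?_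
      have : (⊤ : Ideal (𝓞 K)) ∈ coprimeIdeals Q := by
        intro p _ h
        rw [← Ideal.one_eq_top] at h
        exact (prime_span p).not_isUnit (isUnit_of_dvd_one h)
      rw [Set.indicator_of_mem this, Set.indicator_of_mem (s := {⊤}) rfl]
    by_cases h0 : I = ⊥
    · subst h0
      have : f ⊥ = 0 := by simp [hf]
      have h : ∀ s : Set (Ideal (𝓞 K)), s.indicator f ⊥ = 0 := fun s => by
        by_cases hs : ⊥ ∈ s <;> simp [hs, this]
      simp only [h]
      exact tendsto_const_nhds
    · obtain ⟨p, hp⟩ := exists_primes_dvd h0 h1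
      refine tendsto_const_nhds.congr' ?_
      filter_upwards [Filter.eventually_ge_atTop {p}] with Q hQ
      rw [Set.indicator_of_notMem (s := {⊤}) h1,
        Set.indicator_of_notMem (s := coprimeIdeals Q) fun h => h p (hQ (Finset.mem_singleton_self p)) hp]
  · have hnn : 0 ≤ f I := by simp only [hf]; positivity
    by_cases h : I ∈ coprimeIdeals Q
    · rw [Set.indicator_of_mem h, Real.norm_of_nonneg hnn]
    · rw [Set.indicator_of_notMem h, norm_zero]; exact hnn

/-- The Euler product of `ζ_K(2)`. -/
theorem tendsto_prod_primes :
    Filter.Tendsto (fun Q : Finset primes => ∏ p ∈ Q, (1 - 1 / normK ((p : 𝓞 K) : K) ^ 2))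
      Filter.atTop (𝓝 (NumberField.dedekindZeta K 2).re⁻¹) := by
  have h := tendsto_tsum_coprimeIdeals
  simp only [tsum_coprimeIdeals] at h
  -- Non-vanishing comes for free: otherwise the partial products times the zeta value would all be
  -- 0 yet tend to 1.
  have hz : (NumberField.dedekindZeta K 2).re ≠ 0 := by
    intro hz
    simp only [hz, mul_zero] at h
    exact zero_ne_one (tendsto_nhds_unique tendsto_const_nhds h)
  have h2 := h.mul_const (NumberField.dedekindZeta K 2).re⁻¹
  rw [one_mul] at h2
  refine h2.congr fun Q => ?_
  rw [mul_assoc, mul_inv_cancel₀ hz, mul_one]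

theorem summable_primes : Summable fun p : primes => 1 / normK ((p : 𝓞 K) : K) ^ 2 := by
  refine ((hasSum_absNorm_inv_sq K).summable.comp_injective span_primes_injective).congr
    fun p => ?_
  rw [Function.comp_apply, normK_sq_eq, one_div]

/-! ### Counting lattice points by tiles -/

section Tiles

open MeasureTheory Module

theorem segment_inter_frontier_nonempty {E : Type*} [NormedAddCommGroup E] [NormedSpace ℝ E]
    {S : Set E} {x y : E} (hx : x ∈ S) (hy : y ∉ S) : (segment ℝ x y ∩ frontier S).Nonempty := by
  by_contra h
  rw [Set.not_nonempty_iff_eq_empty] at h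
  have hcov : segment ℝ x y ⊆ interior S ∪ interior Sᶜ := by
    intro z hz
    by_contra hz'
    simp only [Set.mem_union, not_or, interior_compl, Set.mem_compl_iff, not_not] at hz'
    exact Set.eq_empty_iff_forall_notMem.mp h z ⟨hz, hz'.2, hz'.1⟩
  have hxl := left_mem_segment ℝ x y
  have hyl := right_mem_segment ℝ x y
  obtain ⟨z, -, hz1, hz2⟩ := (convex_segment x y).isPreconnected _ _ isOpen_interior
    isOpen_interior hcov
    ⟨x, hxl, (hcov hxl).resolve_right fun h => interior_subset h hx⟩
    ⟨y, hyl, (hcov hyl).resolve_left fun h => hy (interior_subset h)⟩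
  exact interior_subset hz2 (interior_subset hz1)

/-- A segment joining a point of `S` to a point outside it meets the boundary by connectedness. This
confines the counting error to a neighbourhood of the boundary. -/
theorem mem_cthickening_frontier {E : Type*} [NormedAddCommGroup E] [NormedSpace ℝ E]
    {S : Set E} {x y : E} {ε : ℝ} (h : ¬(x ∈ S ↔ y ∈ S)) (hxy : dist x y ≤ ε) :
    x ∈ Metric.cthickening ε (frontier S) := by
  have : (segment ℝ x y ∩ frontier S).Nonempty := by
    by_cases hx : x ∈ S
    · exact segment_inter_frontier_nonempty hx fun hy => h ⟨fun _ => hy, fun _ => hx⟩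
    · rw [segment_symm]
      refine segment_inter_frontier_nonempty (by_contra fun hy => h ?_) hx
      exact ⟨fun h => absurd h hx, fun h => absurd h hy⟩
  obtain ⟨z, hz, hzf⟩ := this
  refine Metric.mem_cthickening_of_dist_le x z ε _ hzf (le_trans ?_ hxy)
  rw [dist_eq_norm, dist_eq_norm]
  obtain ⟨a, b, ha, hb, hab, rfl⟩ := hz
  have : x - (a • x + b • y) = b • (x - y) := by
    have : a = 1 - b := by linarith
    subst this
    module
  rw [this, norm_smul, Real.norm_of_nonneg hb]
  exact mul_le_of_le_one_left (norm_nonneg _) (by linarith)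

variable {E : Type*} [NormedAddCommGroup E] [NormedSpace ℝ E] {ι : Type*} [Fintype ι]

theorem setOf_floor_eq (b : Basis ι ℝ E) {v : E} (hv : v ∈ Submodule.span ℤ (Set.range b)) :
    {y | (ZSpan.floor b y : E) = v} = (fun y => y + -v) ⁻¹' ZSpan.fundamentalDomain b := by
  ext y
  simp only [Set.mem_ofPred_eq, Set.mem_preimage]
  rw [← ZSpan.fract_eq_self, ZSpan.fract_add_ZSpan b y (neg_mem hv), ZSpan.fract_apply]
  constructor
  · intro h; rw [h, sub_eq_add_neg]
  · intro h
    rw [sub_eq_add_neg] at h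
    exact neg_injective (add_left_cancel h)

section

variable [MeasurableSpace E] [BorelSpace E]

/-- The set is a disjoint union of translates of the fundamental domain, one for each lattice point
of `A`; its measure therefore counts those points. -/
theorem measure_setOf_floor_mem (b : Basis ι ℝ E) (μ : Measure E) [μ.IsAddHaarMeasure]
    {A : Set E} (hfin : (A ∩ Submodule.span ℤ (Set.range b)).Finite) :
    μ {y | (ZSpan.floor b y : E) ∈ A} =
      (A ∩ Submodule.span ℤ (Set.range b)).ncard * μ (ZSpan.fundamentalDomain b) := by
  have hU : {y | (ZSpan.floor b y : E) ∈ A} =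
      ⋃ v ∈ hfin.toFinset, {y | (ZSpan.floor b y : E) = v} := by
    ext y
    simp only [Set.mem_ofPred_eq, Set.mem_iUnion, Set.Finite.mem_toFinset, exists_prop,
      exists_eq_right']
    exact ⟨fun h => ⟨h, (ZSpan.floor b y).2⟩, fun h => h.1⟩
  rw [hU, measure_biUnion_finset]
  · rw [Finset.sum_congr rfl (g := fun _ => μ (ZSpan.fundamentalDomain b)), Finset.sum_const,
      nsmul_eq_mul, Set.ncard_eq_toFinset_card _ hfin]
    intro v hv
    rw [setOf_floor_eq b (hfin.mem_toFinset.mp hv).2, measure_preimage_add_right]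
  · intro v _ w _ hvw
    rw [Function.onFun, Set.disjoint_left]
    intro y hy hy'
    exact hvw (hy.symm.trans hy')
  · intro v hv
    rw [setOf_floor_eq b (hfin.mem_toFinset.mp hv).2]
    exact (measurable_add_const _) (ZSpan.fundamentalDomain_measurableSet b)

end

variable [FiniteDimensional ℝ E]

theorem isBounded_linear_preimage {g : E →ₗ[ℝ] E} (hg : LinearMap.det g ≠ 0) {S : Set E}
    (hS : Bornology.IsBounded S) : Bornology.IsBounded (g ⁻¹' S) := by
  let e := LinearMap.equivOfDetNeZero g hg
  have h : g ⁻¹' S = e.symm.toLinearMap.toContinuousLinearMap '' S := by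
    ext x
    constructor
    · intro hx
      exact ⟨g x, hx, e.symm_apply_apply x⟩
    · rintro ⟨y, hy, rfl⟩
      change e (e.symm y) ∈ S
      rwa [e.apply_symm_apply]
  rw [h]
  exact (ContinuousLinearMap.lipschitz _).isBounded_image hS

theorem finite_lattice_inter_preimage (b : Basis ι ℝ E) {g : E →ₗ[ℝ] E}
    (hg : LinearMap.det g ≠ 0) {S : Set E} (hS : Bornology.IsBounded S) :
    (g ⁻¹' S ∩ Submodule.span ℤ (Set.range b)).Finite :=
  ZSpan.setFinite_inter b (isBounded_linear_preimage hg hS)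

variable [MeasurableSpace E] [BorelSpace E]

/-- The number of lattice points in a linear preimage of a bounded set `S`, up to an error
governed by the measure of a neighbourhood of the boundary of `S`. -/
theorem abs_ncard_lattice_sub_le (b : Basis ι ℝ E) (μ : Measure E) [μ.IsAddHaarMeasure]
    {S : Set E} (hS : Bornology.IsBounded S) {g : E →ₗ[ℝ] E} (hg : LinearMap.det g ≠ 0)
    {δ d : ℝ} (hδ : 0 ≤ δ) (hgδ : ∀ x, ‖g x‖ ≤ δ * ‖x‖)
    (hd : ∀ x ∈ ZSpan.fundamentalDomain b, ‖x‖ ≤ d) :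
    |((g ⁻¹' S ∩ Submodule.span ℤ (Set.range b)).ncard : ℝ) *
        μ.real (ZSpan.fundamentalDomain b) * |LinearMap.det g| - μ.real S| ≤
      μ.real (Metric.cthickening (δ * d) (frontier S)) := by
  set n := (g ⁻¹' S ∩ Submodule.span ℤ (Set.range b)).ncard with hn
  set F := ZSpan.fundamentalDomain b with hF
  set U := {y | (ZSpan.floor b y : E) ∈ g ⁻¹' S} with hU
  set B := Metric.cthickening (δ * d) (frontier S) with hB
  have hUm : μ U = n * μ F :=
    measure_setOf_floor_mem b μ (finite_lattice_inter_preimage b hg hS)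
  -- A point and its lattice floor differ by a vector of the fundamental domain, which `g` shrinks
  -- to length at most `δ * d`. So `g ⁻¹' S` and the union `U` of tiles differ only inside `g ⁻¹'
  -- B`.
  have hkey : ∀ y, ¬(y ∈ g ⁻¹' S ↔ y ∈ U) → y ∈ g ⁻¹' B := by
    intro y hy
    refine mem_cthickening_frontier (y := g (ZSpan.floor b y)) hy ?_
    rw [dist_eq_norm, ← map_sub, ← ZSpan.fract_apply]
    exact (hgδ _).trans (mul_le_mul_of_nonneg_left
      (hd _ (ZSpan.fract_mem_fundamentalDomain b y)) hδ)
  have hpre : ∀ X, μ.real (g ⁻¹' X) = |(LinearMap.det g)|⁻¹ * μ.real X := by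
    intro X
    rw [measureReal_def, Measure.addHaar_preimage_linearMap μ hg, ENNReal.toReal_mul,
      ENNReal.toReal_ofReal (abs_nonneg _), abs_inv, measureReal_def]
  have hBb : Bornology.IsBounded B :=
    (hS.closure.subset frontier_subset_closure).cthickening
  have hfinA : μ (g ⁻¹' S) ≠ ⊤ := (isBounded_linear_preimage hg hS).measure_lt_top.ne
  have hfinB : μ (g ⁻¹' B) ≠ ⊤ := (isBounded_linear_preimage hg hBb).measure_lt_top.ne
  have hFb : Bornology.IsBounded F := ZSpan.fundamentalDomain_isBounded b
  have hfinU : μ U ≠ ⊤ := by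
    rw [hUm]
    exact ENNReal.mul_ne_top (ENNReal.natCast_ne_top n) hFb.measure_lt_top.ne
  have h1 : μ.real (g ⁻¹' S) ≤ μ.real U + μ.real (g ⁻¹' B) := by
    refine (measureReal_mono (fun y hy => ?_) (measure_union_ne_top hfinU hfinB)).trans
      (measureReal_union_le _ _)
    by_cases h : y ∈ U
    · exact Or.inl h
    · exact Or.inr (hkey y fun h' => h (h'.mp hy))
  have h2 : μ.real U ≤ μ.real (g ⁻¹' S) + μ.real (g ⁻¹' B) := by
    refine (measureReal_mono (fun y hy => ?_) (measure_union_ne_top hfinA hfinB)).trans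
      (measureReal_union_le _ _)
    by_cases h : y ∈ g ⁻¹' S
    · exact Or.inl h
    · exact Or.inr (hkey y fun h' => h (h'.mpr hy))
  have hUr : μ.real U = n * μ.real F := by
    rw [measureReal_def, hUm, ENNReal.toReal_mul, ENNReal.toReal_natCast, measureReal_def]
  rw [hpre, hpre, hUr] at h1 h2
  have hdpos : 0 < |LinearMap.det g| := abs_pos.mpr hg
  have e1 : ∀ X : ℝ, |LinearMap.det g| * (|LinearMap.det g|⁻¹ * X) = X := fun X => by
    rw [← mul_assoc, mul_inv_cancel₀ hdpos.ne', one_mul]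
  have h1' := mul_le_mul_of_nonneg_left h1 hdpos.le
  have h2' := mul_le_mul_of_nonneg_left h2 hdpos.le
  rw [mul_add, e1, e1] at h1' h2'
  rw [abs_le]
  constructor <;> nlinarith

end Tiles

/-! ### The lattice of the points `(x, σ(x))` with `x ∈ ℤ[ζ]` -/

theorem zeta8_eq : zeta8 = ((√2 / 2 : ℝ) : ℂ) * (1 + Complex.I) := by
  rw [zeta8, show (2 * Real.pi * Complex.I / 8 : ℂ) = ((Real.pi / 4 : ℝ) : ℂ) * Complex.I by
    push_cast; ring, Complex.exp_mul_I, ← Complex.ofReal_cos, ← Complex.ofReal_sin,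
    Real.cos_pi_div_four, Real.sin_pi_div_four]
  ring

theorem zeta8_re : zeta8.re = √2 / 2 := by rw [zeta8_eq]; simp

theorem zeta8_im : zeta8.im = √2 / 2 := by rw [zeta8_eq]; simp

theorem zeta8_sq : zeta8 ^ 2 = Complex.I := by
  have h : ((√2 : ℝ) : ℂ) ^ 2 = 2 := by exact_mod_cast sqrt_two_sq
  rw [zeta8_eq]
  push_cast
  linear_combination (1 / 4 * (1 + Complex.I) ^ 2) * h + 1 / 2 * Complex.I_sq

theorem zeta8_cube : zeta8 ^ 3 = ((√2 / 2 : ℝ) : ℂ) * (-1 + Complex.I) := by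
  rw [pow_succ, zeta8_sq, zeta8_eq]
  linear_combination ((√2 / 2 : ℝ) : ℂ) * Complex.I_sq

theorem zeta8_cube_re : (zeta8 ^ 3).re = -(√2 / 2) := by rw [zeta8_cube]; simp

theorem zeta8_cube_im : (zeta8 ^ 3).im = √2 / 2 := by rw [zeta8_cube]; simp

/-- The point `α + βζ` of `ℤ[ζ]`. -/
def pt₁ (p : 𝓞 K × 𝓞 K) : ℂ := emb₁ (p.1 : K) + emb₁ (p.2 : K) * zeta8

/-- The conjugate `σ(α) + σ(β)ζ³` of the point `α + βζ`. -/
def pt₂ (p : 𝓞 K × 𝓞 K) : ℂ := emb₂ (p.1 : K) + emb₂ (p.2 : K) * zeta8 ^ 3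

theorem pt₁_injective : Function.Injective pt₁ := by
  rintro ⟨a, b⟩ ⟨c, d⟩ h
  have him := congrArg Complex.im h
  have hre := congrArg Complex.re h
  simp only [pt₁, Complex.add_im, Complex.add_re, Complex.ofReal_im, Complex.ofReal_re,
    Complex.mul_im, Complex.mul_re, zeta8_re, zeta8_im, zero_mul, add_zero, zero_add,
    sub_zero] at him hre
  have hs : (√2 / 2 : ℝ) ≠ 0 := by positivity
  have hb := mul_right_cancel₀ hs him
  rw [hb] at hre
  have ha := add_right_cancel hre
  rw [NumberField.RingOfIntegers.ext (emb₁_injective ha),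
    NumberField.RingOfIntegers.ext (emb₁_injective hb)]

/-- The standard real basis of `ℂ × ℂ`. -/
def stdBasis : Module.Basis (Fin 4) ℝ (ℂ × ℂ) :=
  (Complex.basisOneI.prod Complex.basisOneI).reindex finSumFinEquiv

theorem stdBasis_repr (x : ℂ × ℂ) :
    ⇑(stdBasis.repr x) = ![x.1.re, x.1.im, x.2.re, x.2.im] := by
  ext i
  fin_cases i
  · simp only [stdBasis, Module.Basis.repr_reindex_apply]
    change (Complex.basisOneI.prod Complex.basisOneI).repr x (Sum.inl 0) = _
    simp
  · simp only [stdBasis, Module.Basis.repr_reindex_apply]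
    change (Complex.basisOneI.prod Complex.basisOneI).repr x (Sum.inl 1) = _
    simp
  · simp only [stdBasis, Module.Basis.repr_reindex_apply]
    change (Complex.basisOneI.prod Complex.basisOneI).repr x (Sum.inr 0) = _
    simp
  · simp only [stdBasis, Module.Basis.repr_reindex_apply]
    change (Complex.basisOneI.prod Complex.basisOneI).repr x (Sum.inr 1) = _
    simp

/-- The vectors `(x, σ(x))` for `x = 1, √2, ζ, √2ζ`. -/
def latticeVec : Fin 4 → ℂ × ℂ :=
  ![(1, 1), (√2, -√2), (zeta8, zeta8 ^ 3), (√2 * zeta8, -√2 * zeta8 ^ 3)]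

/-- This gives the covolume of the lattice, the source of the factor 4 in the density. -/
theorem det_latticeVec : stdBasis.det latticeVec = -4 := by
  have h := sqrt_two_sq
  have h1 : (√2 * (√2 / 2) : ℝ) = 1 := by linear_combination h / 2
  rw [Module.Basis.det_apply]
  have hm : stdBasis.toMatrix latticeVec =
      !![1, √2, √2 / 2, 1; 0, 0, √2 / 2, 1; 1, -√2, -(√2 / 2), 1; 0, 0, √2 / 2, -1] := by
    ext i j
    rw [Module.Basis.toMatrix_apply, stdBasis_repr]
    fin_cases i <;> fin_cases j <;>
      simp [latticeVec, zeta8_re, zeta8_im, zeta8_cube_re, zeta8_cube_im, h1]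
  rw [hm]
  simp [Matrix.det_succ_row_zero, Fin.sum_univ_succ, Fin.succAbove]
  linear_combination -h

theorem isBasis_latticeVec :
    LinearIndependent ℝ latticeVec ∧ Submodule.span ℝ (Set.range latticeVec) = ⊤ := by
  rw [Module.Basis.is_basis_iff_det stdBasis, det_latticeVec]
  exact isUnit_iff_ne_zero.mpr (by norm_num)

/-- The basis of the lattice of the points `(x, σ(x))` with `x ∈ ℤ[ζ]`. -/
def latticeBasis : Module.Basis (Fin 4) ℝ (ℂ × ℂ) :=
  Module.Basis.mk isBasis_latticeVec.1 isBasis_latticeVec.2.ge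

theorem coe_latticeBasis : ⇑latticeBasis = latticeVec := Module.Basis.coe_mk _ _

open MeasureTheory in
theorem volume_fundamentalDomain_stdBasis :
    volume (ZSpan.fundamentalDomain stdBasis) = 1 := by
  have hC : volume (Complex.measurableEquivPi ⁻¹' (Set.univ.pi fun _ => Set.Ico (0 : ℝ) 1)) =
      1 := by
    rw [Complex.volume_preserving_equiv_pi.measure_preimage
      (MeasurableSet.pi Set.countable_univ (fun _ _ => measurableSet_Ico)).nullMeasurableSet,
      volume_pi, Measure.pi_pi]
    simp
  have : ZSpan.fundamentalDomain stdBasis =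
      (Complex.measurableEquivPi ⁻¹' (Set.univ.pi fun _ => Set.Ico (0 : ℝ) 1)) ×ˢ
      (Complex.measurableEquivPi ⁻¹' (Set.univ.pi fun _ => Set.Ico (0 : ℝ) 1)) := by
    ext x
    simp [ZSpan.mem_fundamentalDomain, stdBasis_repr, Complex.measurableEquivPi,
      Fin.forall_fin_succ]
    tauto
  rw [this, Measure.volume_eq_prod, Measure.prod_prod, hC, one_mul]

instance isAddHaarMeasure_volume_prod :
    (MeasureTheory.volume : MeasureTheory.Measure (ℂ × ℂ)).IsAddHaarMeasure :=
  inferInstanceAs ((MeasureTheory.volume.prod MeasureTheory.volume :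
    MeasureTheory.Measure (ℂ × ℂ)).IsAddHaarMeasure)

open MeasureTheory in
theorem volume_fundamentalDomain_latticeBasis :
    volume.real (ZSpan.fundamentalDomain latticeBasis) = 4 := by
  rw [ZSpan.measureReal_fundamentalDomain latticeBasis volume stdBasis, coe_latticeBasis,
    det_latticeVec, measureReal_def, volume_fundamentalDomain_stdBasis]
  norm_num

/-- The pairs of integers of `K` have the ℤ-basis `1, √2, ζ, √2ζ`, whose images are the chosen
lattice vectors. -/
theorem range_pt :
    Set.range (fun p => (pt₁ p, pt₂ p)) =
      (Submodule.span ℤ (Set.range latticeBasis) : Set (ℂ × ℂ)) := by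
  have key : ∀ c : Fin 4 → ℤ, ∑ i, c i • latticeVec i =
      (pt₁ (c 0 + c 1 * sqrt2Int, c 2 + c 3 * sqrt2Int),
        pt₂ (c 0 + c 1 * sqrt2Int, c 2 + c 3 * sqrt2Int)) := by
    intro c
    rw [Fin.sum_univ_four, pt₁, pt₂, emb₁_int_repr, emb₁_int_repr, emb₂_int_repr, emb₂_int_repr]
    ext1
    · simp [latticeVec]; ring
    · simp [latticeVec]; ring
  rw [coe_latticeBasis]
  ext x
  rw [SetLike.mem_coe, Submodule.mem_span_range_iff_exists_fun]
  constructor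
  · rintro ⟨⟨α, β⟩, rfl⟩
    obtain ⟨a, b, rfl⟩ := exists_int_repr α
    obtain ⟨c, d, rfl⟩ := exists_int_repr β
    exact ⟨![a, b, c, d], key _⟩
  · rintro ⟨c, rfl⟩
    exact ⟨_, (key c).symm⟩

theorem pt_injective : Function.Injective fun p => (pt₁ p, pt₂ p) :=
  fun _ _ h => pt₁_injective (congrArg Prod.fst h)

/-- The parameters of the points `x ∈ ℤ[ζ]` with `a x ∈ D` and `b σ(x) ∈ V`. -/
def ptSet (a b : ℝ) (D V : Set ℂ) : Set (𝓞 K × 𝓞 K) :=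
  {p | (a : ℂ) * pt₁ p ∈ D ∧ (b : ℂ) * pt₂ p ∈ V}

/-- The diagonal map `(x, y) ↦ (a x, b y)`. -/
def diagMap (a b : ℝ) : ℂ × ℂ →ₗ[ℝ] ℂ × ℂ :=
  LinearMap.prodMap (a • LinearMap.id) (b • LinearMap.id)

theorem det_diagMap (a b : ℝ) : LinearMap.det (diagMap a b) = (a * b) ^ 2 := by
  rw [diagMap, LinearMap.det_prodMap, LinearMap.det_smul, LinearMap.det_smul]
  simp [mul_pow]

theorem image_ptSet (a b : ℝ) (D V : Set ℂ) :
    (fun p => (pt₁ p, pt₂ p)) '' ptSet a b D V =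
      diagMap a b ⁻¹' (D ×ˢ V) ∩ Submodule.span ℤ (Set.range latticeBasis) := by
  rw [← range_pt]
  ext x
  simp only [ptSet, diagMap, Set.mem_image, Set.mem_inter_iff, Set.mem_range]
  constructor
  · rintro ⟨p, hp, rfl⟩
    exact ⟨by simpa using hp, p, rfl⟩
  · rintro ⟨h, p, rfl⟩
    exact ⟨p, by simpa using h, rfl⟩

theorem finite_ptSet {a b : ℝ} (ha : a ≠ 0) (hb : b ≠ 0) {D V : Set ℂ}
    (hD : Bornology.IsBounded D) (hV : Bornology.IsBounded V) : (ptSet a b D V).Finite := by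
  refine Set.Finite.of_finite_image (f := fun p => (pt₁ p, pt₂ p)) ?_ pt_injective.injOn
  rw [image_ptSet]
  refine finite_lattice_inter_preimage _ ?_ (hD.prod hV)
  rw [det_diagMap]
  exact pow_ne_zero _ (mul_ne_zero ha hb)

open MeasureTheory in
theorem volume_frontier_prod {D V : Set ℂ} (hD : JordanMeasurable D) (hV : JordanMeasurable V) :
    volume (frontier (D ×ˢ V)) = 0 := by
  rw [frontier_prod_eq]
  refine measure_union_null ?_ ?_
  · rw [Measure.volume_eq_prod, Measure.prod_prod, hV.2, mul_zero]
  · rw [Measure.volume_eq_prod, Measure.prod_prod, hD.2, zero_mul]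

-- The boundary of `D ×ˢ V` is a null set, so its closed thickenings have arbitrarily small measure,
-- and this measure bounds the error of the tile count.
open MeasureTheory in
theorem exists_abs_ncard_sub_lt_of_small {D V : Set ℂ} (hD : JordanMeasurable D)
    (hV : JordanMeasurable V) {ε : ℝ} (hε : 0 < ε) :
    ∃ δ > 0, ∀ a b : ℝ, a ≠ 0 → b ≠ 0 → |a| < δ → |b| < δ →
      |((ptSet a b D V).ncard : ℝ) * (a * b) ^ 2 * 4 - volume.real D * volume.real V| < ε := by
  have hbd : Bornology.IsBounded (D ×ˢ V) := hD.1.prod hV.1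
  have hbf : Bornology.IsBounded (frontier (D ×ˢ V)) :=
    hbd.closure.subset frontier_subset_closure
  obtain ⟨d, hd0, hd⟩ : ∃ d > 0, ∀ x ∈ ZSpan.fundamentalDomain latticeBasis, ‖x‖ ≤ d := by
    obtain ⟨d, hd0, hd⟩ := (ZSpan.fundamentalDomain_isBounded latticeBasis).exists_pos_norm_le
    exact ⟨d, hd0, hd⟩
  have hlim := tendsto_measure_cthickening_of_isClosed (μ := (volume : Measure (ℂ × ℂ)))
    (s := frontier (D ×ˢ V)) ⟨1, one_pos, hbf.cthickening.measure_lt_top.ne⟩ isClosed_frontier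
  rw [volume_frontier_prod hD hV] at hlim
  have hev := (tendsto_order.mp hlim).2 (ENNReal.ofReal ε) (ENNReal.ofReal_pos.mpr hε)
  obtain ⟨η, hη, hη'⟩ := Metric.eventually_nhds_iff.mp hev
  -- This makes the thickening radius `η / 2`, strictly below the threshold `η`.
  refine ⟨η / (2 * d), by positivity, fun a b ha hb haδ hbδ => ?_⟩
  have hdet : LinearMap.det (diagMap a b) ≠ 0 := by
    rw [det_diagMap]
    exact pow_ne_zero _ (mul_ne_zero ha hb)
  have hg : ∀ x, ‖diagMap a b x‖ ≤ η / (2 * d) * ‖x‖ := by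
    rintro ⟨x, y⟩
    simp only [diagMap, LinearMap.prodMap_apply, LinearMap.smul_apply, LinearMap.id_apply]
    refine max_le ?_ ?_
    · rw [norm_smul, Real.norm_eq_abs]
      exact mul_le_mul haδ.le (le_max_left _ _) (norm_nonneg _) (by positivity)
    · rw [norm_smul, Real.norm_eq_abs]
      exact mul_le_mul hbδ.le (le_max_right _ _) (norm_nonneg _) (by positivity)
  have h := abs_ncard_lattice_sub_le latticeBasis volume hbd hdet (by positivity) hg hd
  rw [volume_fundamentalDomain_latticeBasis, ← image_ptSet,
    Set.ncard_image_of_injective _ pt_injective, det_diagMap, abs_of_nonneg (sq_nonneg (a * b)),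
    Measure.volume_eq_prod, measureReal_prod_prod] at h
  have hprod : ((ptSet a b D V).ncard : ℝ) * 4 * (a * b) ^ 2 =
      (ptSet a b D V).ncard * (a * b) ^ 2 * 4 := by ring
  rw [hprod] at h
  refine h.trans_lt ?_
  rw [← Measure.volume_eq_prod, measureReal_def]
  refine ENNReal.toReal_lt_of_lt_ofReal (hη' ?_)
  rw [Real.dist_eq, sub_zero, abs_of_nonneg (by positivity)]
  field_simp
  norm_num

/-- Multiplication of the parameters by a unit. -/
def unitMulEquiv (u : (𝓞 K)ˣ) : 𝓞 K × 𝓞 K ≃ 𝓞 K × 𝓞 K :=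
  (Units.mulLeft u).prodCongr (Units.mulLeft u)

theorem pt₁_mul (c : 𝓞 K) (p : 𝓞 K × 𝓞 K) :
    pt₁ (c * p.1, c * p.2) = emb₁ (c : K) * pt₁ p := by
  simp only [pt₁, map_mul]
  push_cast
  ring

theorem pt₂_mul (c : 𝓞 K) (p : 𝓞 K × 𝓞 K) :
    pt₂ (c * p.1, c * p.2) = emb₂ (c : K) * pt₂ p := by
  simp only [pt₂, map_mul]
  push_cast
  ring

/-- Multiplication by a unit permutes `ℤ[ζ]`. It changes the two scalings separately while
preserving the modulus of their product. -/
theorem ncard_ptSet_unit (u : (𝓞 K)ˣ) (a b : ℝ) (D V : Set ℂ) :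
    (ptSet (a * emb₁ ((u : 𝓞 K) : K)) (b * emb₂ ((u : 𝓞 K) : K)) D V).ncard =
      (ptSet a b D V).ncard := by
  have : unitMulEquiv u '' ptSet (a * emb₁ ((u : 𝓞 K) : K)) (b * emb₂ ((u : 𝓞 K) : K)) D V =
      ptSet a b D V := by
    rw [Equiv.image_eq_preimage_symm]
    ext p
    obtain ⟨q, rfl⟩ := (unitMulEquiv u).surjective p
    rw [Set.mem_preimage, Equiv.symm_apply_apply]
    have e1 : pt₁ (unitMulEquiv u q) = _ := pt₁_mul u q
    have e2 : pt₂ (unitMulEquiv u q) = _ := pt₂_mul u q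
    change _ ∧ _ ↔ _ ∧ _
    rw [e1, e2]
    push_cast
    simp only [mul_assoc]
  rw [← this, Set.ncard_image_of_injective _ (unitMulEquiv u).injective]

theorem abs_emb₁_mul_emb₂_unit (u : (𝓞 K)ˣ) :
    |emb₁ ((u : 𝓞 K) : K) * emb₂ ((u : 𝓞 K) : K)| = 1 :=
  isUnit_iff_abs_normK.mp u.isUnit

-- Only the product `a * b` has to be small: a power of `λ` enlarges one scaling and shrinks the
-- other until both are below the threshold of the previous lemma.
open MeasureTheory in
theorem exists_abs_ncard_sub_lt {D V : Set ℂ} (hD : JordanMeasurable D)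
    (hV : JordanMeasurable V) {ε : ℝ} (hε : 0 < ε) :
    ∃ δ > 0, ∀ a b : ℝ, a * b ≠ 0 → |a * b| < δ →
      |((ptSet a b D V).ncard : ℝ) * (a * b) ^ 2 * 4 - volume.real D * volume.real V| < ε := by
  obtain ⟨δ, hδ, h⟩ := exists_abs_ncard_sub_lt_of_small hD hV hε
  have hl := one_lt_emb₁_lam
  have hl0 : 0 < emb₁ lam := by linarith
  -- The power `λ ^ k` is chosen with `δ / λ ≤ λ ^ k |a| < δ`; then `λ ^ (-k) |b| ≤ |a b| λ / δ`,
  -- which this bound makes less than `δ`.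
  refine ⟨δ ^ 2 / emb₁ lam, by positivity, fun a b hab hlt => ?_⟩
  have ha := left_ne_zero_of_mul hab
  have hb := right_ne_zero_of_mul hab
  obtain ⟨k, hk1, hk2⟩ := exists_mem_Ioc_zpow (show 0 < δ / |a| by positivity) hl
  set u := lamUnit ^ k with hu
  have hu1 : emb₁ ((u : 𝓞 K) : K) = emb₁ lam ^ k := by rw [hu, coe_lamUnit_zpow, map_zpow₀]
  have hpos : 0 < emb₁ lam ^ k := zpow_pos hl0 k
  have huu := abs_emb₁_mul_emb₂_unit u
  have hu2 : |emb₂ ((u : 𝓞 K) : K)| = (emb₁ lam ^ k)⁻¹ := by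
    rw [abs_mul, hu1, abs_of_pos hpos] at huu
    exact eq_inv_of_mul_eq_one_right huu
  have hprod : (a * emb₁ ((u : 𝓞 K) : K) * (b * emb₂ ((u : 𝓞 K) : K))) ^ 2 = (a * b) ^ 2 := by
    rw [sq_eq_sq_iff_abs_eq_abs, show a * emb₁ ((u : 𝓞 K) : K) * (b * emb₂ ((u : 𝓞 K) : K)) =
      a * b * (emb₁ ((u : 𝓞 K) : K) * emb₂ ((u : 𝓞 K) : K)) by ring, abs_mul, huu, mul_one]
  have hne : ∀ φ : K →+* ℝ, φ ((u : 𝓞 K) : K) ≠ 0 := fun φ =>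
    (map_ne_zero φ).mpr (coe_ne_zero u.ne_zero)
  have := h (a * emb₁ ((u : 𝓞 K) : K)) (b * emb₂ ((u : 𝓞 K) : K))
    (mul_ne_zero ha (hne _)) (mul_ne_zero hb (hne _)) ?_ ?_
  · rwa [ncard_ptSet_unit, hprod] at this
  · rw [abs_mul, hu1, abs_of_pos hpos, mul_comm, ← lt_div_iff₀ (abs_pos.mpr ha)]
    exact hk1
  · have hapos := abs_pos.mpr ha
    rw [abs_mul, hu2, ← div_eq_mul_inv, div_lt_iff₀ hpos]
    rw [abs_mul, lt_div_iff₀ hl0] at hlt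
    rw [zpow_add_one₀ hl0.ne', div_le_iff₀ hapos] at hk2
    by_contra! hcon
    have h1 : δ * δ ≤ δ * (emb₁ lam ^ k * emb₁ lam * |a|) := by gcongr
    have h2 : (δ * emb₁ lam ^ k) * (emb₁ lam * |a|) ≤ |b| * (emb₁ lam * |a|) := by gcongr
    nlinarith

/-! ### Counting multiples -/

theorem normSq_pt₁ (p : 𝓞 K × 𝓞 K) :
    ‖pt₁ p‖ ^ 2 = emb₁ ((p.1 ^ 2 + sqrt2Int * p.1 * p.2 + p.2 ^ 2 : 𝓞 K) : K) := by
  rw [← Complex.normSq_eq_norm_sq, Complex.normSq_apply]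
  simp only [pt₁, Complex.add_im, Complex.add_re, Complex.ofReal_im, Complex.ofReal_re,
    Complex.mul_im, Complex.mul_re, zeta8_re, zeta8_im, map_add,
    map_mul, map_pow, coe_sqrt2Int, emb₁_sqrt2]
  linear_combination ((emb₁ p.2) ^ 2 / 2) * sqrt_two_sq

theorem normSq_pt₂ (p : 𝓞 K × 𝓞 K) :
    ‖pt₂ p‖ ^ 2 = emb₂ ((p.1 ^ 2 + sqrt2Int * p.1 * p.2 + p.2 ^ 2 : 𝓞 K) : K) := by
  rw [← Complex.normSq_eq_norm_sq, Complex.normSq_apply]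
  simp only [pt₂, Complex.add_im, Complex.add_re, Complex.ofReal_im, Complex.ofReal_re,
    Complex.mul_im, Complex.mul_re, zeta8_cube_re, zeta8_cube_im,
    map_add, map_mul, map_pow, coe_sqrt2Int, emb₂_sqrt2]
  linear_combination ((emb₂ p.2) ^ 2 / 2) * sqrt_two_sq

theorem pt₁_zero : pt₁ 0 = 0 := by simp [pt₁]

theorem pt₂_zero : pt₂ 0 = 0 := by simp [pt₂]

/-- For `x = α + βζ`, `|x|²` and `|σ(x)|²` are the two conjugates of the integer `α² + √2 αβ + β²`
of `K`, whose norm has modulus at least 1 unless it vanishes. -/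
theorem one_le_norm_pt_mul {p : 𝓞 K × 𝓞 K} (hp : p ≠ 0) : 1 ≤ ‖pt₁ p‖ * ‖pt₂ p‖ := by
  have h1 := normSq_pt₁ p
  have h2 := normSq_pt₂ p
  set n : 𝓞 K := p.1 ^ 2 + sqrt2Int * p.1 * p.2 + p.2 ^ 2
  have hn : n ≠ 0 := by
    intro h
    rw [h, coe_zero, map_zero, sq_eq_zero_iff, norm_eq_zero, ← pt₁_zero] at h1
    exact hp (pt₁_injective h1)
  have h := one_le_abs_normK hn
  rw [normK_eq, ← h1, ← h2, ← mul_pow, abs_of_nonneg (sq_nonneg _)] at h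
  exact (one_le_sq_iff₀ (by positivity)).mp h

theorem jordanMeasurable_closedBall (R : ℝ) : JordanMeasurable (Metric.closedBall (0 : ℂ) R) :=
  ⟨Metric.isBounded_closedBall, (convex_closedBall _ _).addHaar_frontier _⟩

/-- There are two regimes. If `|a b| > R²`, no non-zero point satisfies both conditions. If `|a b| ≤
R²`, shrinking `a` by a fixed factor only enlarges the set and brings it into the range of the
asymptotic count. -/
theorem exists_ncard_ptSet_le (R : ℝ) :
    ∃ C : ℝ, 0 ≤ C ∧ ∀ a b : ℝ, a * b ≠ 0 →
      ((ptSet a b (Metric.closedBall 0 R) (Metric.closedBall 0 R) \ {0}).ncard : ℝ) *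
        (a * b) ^ 2 ≤ C := by
  have hJ := jordanMeasurable_closedBall R
  obtain ⟨δ, hδ, h⟩ := exists_abs_ncard_sub_lt hJ hJ one_pos
  set B := Metric.closedBall (0 : ℂ) R with hB
  set v := MeasureTheory.volume.real B
  -- Chosen so that `s ≤ 1` and `s * R ^ 2 < δ`.
  set s : ℝ := δ / (δ + R ^ 2 + 1) with hs
  have hs0 : 0 < s := by positivity
  have hs1 : s ≤ 1 := by
    rw [hs, div_le_one (by positivity)]
    nlinarith [sq_nonneg R]
  refine ⟨(v * v + 1) / (4 * s ^ 2), by positivity, fun a b hab => ?_⟩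
  have ha := left_ne_zero_of_mul hab
  have hb := right_ne_zero_of_mul hab
  by_cases hR : |a * b| ≤ R ^ 2
  · have h1 := h (s * a) b (by rw [mul_assoc]; exact mul_ne_zero hs0.ne' hab) (by
      rw [mul_assoc, abs_mul, abs_of_pos hs0, hs, div_mul_eq_mul_div, div_lt_iff₀ (by positivity)]
      nlinarith)
    have h2 : (ptSet a b B B \ {0}).ncard ≤ (ptSet (s * a) b B B).ncard := by
      refine Set.ncard_le_ncard ?_ (finite_ptSet (mul_ne_zero hs0.ne' ha) hb hJ.1 hJ.1)
      rintro p ⟨⟨hp1, hp2⟩, -⟩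
      refine ⟨?_, hp2⟩
      rw [hB, mem_closedBall_zero_iff] at hp1 ⊢
      rw [Complex.ofReal_mul, mul_assoc, norm_mul, Complex.norm_real, Real.norm_of_nonneg hs0.le]
      exact (mul_le_of_le_one_left (norm_nonneg _) hs1).trans hp1
    have h2' : ((ptSet a b B B \ {0}).ncard : ℝ) ≤ (ptSet (s * a) b B B).ncard := by
      exact_mod_cast h2
    rw [le_div_iff₀ (by positivity)]
    have h3 := (abs_lt.mp h1).2
    have h4 := mul_le_mul_of_nonneg_right h2' (show 0 ≤ (s * a * b) ^ 2 * 4 by positivity)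
    nlinarith
  · have : ptSet a b B B \ {0} = ∅ := by
      rw [Set.eq_empty_iff_forall_notMem]
      rintro p ⟨⟨hp1, hp2⟩, hp0⟩
      rw [hB, mem_closedBall_zero_iff, norm_mul, Complex.norm_real, Real.norm_eq_abs] at hp1 hp2
      have hp := one_le_norm_pt_mul hp0
      apply hR
      calc |a * b| ≤ |a * b| * (‖pt₁ p‖ * ‖pt₂ p‖) := le_mul_of_one_le_right (abs_nonneg _) hp
        _ = (|a| * ‖pt₁ p‖) * (|b| * ‖pt₂ p‖) := by rw [abs_mul]; ring
        _ ≤ R * R := mul_le_mul hp1 hp2 (by positivity) ((by positivity : (0 : ℝ) ≤ _).trans hp1)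
        _ = R ^ 2 := (sq R).symm
    rw [this]
    simp only [Set.ncard_empty, Nat.cast_zero, zero_mul]
    positivity

/-- The parameters of the points `x ∈ ℤ[ζ]` with `x ∈ TD` and `σ(x) ∈ V` that are multiples of
`L` but of no element of `Q`. -/
def sieveSet (Q : Finset primes) (L : 𝓞 K) (D V : Set ℂ) (T : ℝ) : Set (𝓞 K × 𝓞 K) :=
  {p | (L ∣ p.1 ∧ L ∣ p.2) ∧ (∀ q ∈ Q, ¬ ((q : 𝓞 K) ∣ p.1 ∧ (q : 𝓞 K) ∣ p.2)) ∧
    pt₁ p ∈ T • D ∧ pt₂ p ∈ V}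

theorem mul_pair_injective {L : 𝓞 K} (hL : L ≠ 0) :
    Function.Injective fun q : 𝓞 K × 𝓞 K => (L * q.1, L * q.2) := by
  rintro ⟨a, b⟩ ⟨c, d⟩ h
  simp only [Prod.mk.injEq, mul_right_inj' hL] at h
  rw [h.1, h.2]

theorem mem_smul_iff_inv_mul_mem {T : ℝ} (hT : T ≠ 0) {D : Set ℂ} {z : ℂ} :
    z ∈ T • D ↔ ((T⁻¹ : ℝ) : ℂ) * z ∈ D := by
  rw [Set.mem_smul_set_iff_inv_smul_mem₀ hT, Complex.real_smul]

theorem image_ptSet_mul {L : 𝓞 K} (D V : Set ℂ) {T : ℝ} (hT : T ≠ 0) :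
    (fun q : 𝓞 K × 𝓞 K => (L * q.1, L * q.2)) ''
      ptSet (emb₁ (L : K) / T) (emb₂ (L : K)) D V = sieveSet ∅ L D V T := by
  ext p
  constructor
  · rintro ⟨q, ⟨h1, h2⟩, rfl⟩
    refine ⟨⟨dvd_mul_right _ _, dvd_mul_right _ _⟩, by simp, ?_, ?_⟩
    · rw [mem_smul_iff_inv_mul_mem hT, pt₁_mul]
      convert h1 using 1
      push_cast; ring
    · rwa [pt₂_mul]
  · rintro ⟨⟨⟨a, ha⟩, ⟨b, hb⟩⟩, -, h1, h2⟩
    have hp : p = (L * (a, b).1, L * (a, b).2) := Prod.ext ha hb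
    rw [hp] at h1 h2 ⊢
    refine ⟨(a, b), ⟨?_, ?_⟩, rfl⟩
    · rw [mem_smul_iff_inv_mul_mem hT, pt₁_mul] at h1
      convert h1 using 1
      push_cast; ring
    · rwa [pt₂_mul] at h2

theorem ncard_sieveSet_empty {L : 𝓞 K} (hL : L ≠ 0) (D V : Set ℂ) {T : ℝ} (hT : T ≠ 0) :
    (sieveSet ∅ L D V T).ncard = (ptSet (emb₁ (L : K) / T) (emb₂ (L : K)) D V).ncard := by
  rw [← image_ptSet_mul D V hT, Set.ncard_image_of_injective _ (mul_pair_injective hL)]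

theorem finite_sieveSet (Q : Finset primes) (L : 𝓞 K) {D V : Set ℂ}
    (hD : Bornology.IsBounded D) (hV : Bornology.IsBounded V) (T : ℝ) :
    (sieveSet Q L D V T).Finite := by
  refine (finite_ptSet one_ne_zero one_ne_zero (hD.smul₀ T) hV).subset fun p hp => ?_
  exact ⟨by simpa using hp.2.2.1, by simpa using hp.2.2.2⟩

theorem volume_real_smul (T : ℝ) (D : Set ℂ) :
    MeasureTheory.volume.real (T • D) = T ^ 2 * MeasureTheory.volume.real D := by
  rw [MeasureTheory.measureReal_def, MeasureTheory.Measure.addHaar_smul, ENNReal.toReal_mul,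
    Complex.finrank_real_complex, ENNReal.toReal_ofReal (abs_nonneg _),
    abs_of_nonneg (sq_nonneg T), MeasureTheory.measureReal_def]

theorem JordanMeasurable.volume_real_pos {D : Set ℂ} (hD : JordanMeasurable D)
    (h : 0 < MeasureTheory.volume D) : 0 < MeasureTheory.volume.real D :=
  ENNReal.toReal_pos h.ne' hD.1.measure_lt_top.ne

-- Dividing by `L` turns the count into one for all of `ℤ[ζ]` with scalings of product `N(L) / T`,
-- which tends to 0.
open Filter in
theorem tendsto_sieveSet_empty {L : 𝓞 K} (hL : L ≠ 0) {D V : Set ℂ} (hD : JordanMeasurable D)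
    (hD0 : 0 < MeasureTheory.volume D) (hV : JordanMeasurable V) :
    Tendsto (fun T : ℝ => ((sieveSet ∅ L D V T).ncard : ℝ) / MeasureTheory.volume.real (T • D))
      atTop (𝓝 (MeasureTheory.volume.real V / (4 * normK (L : K) ^ 2))) := by
  have hv := hD.volume_real_pos hD0
  have hN := normK_ne_zero (coe_ne_zero hL)
  set d := MeasureTheory.volume.real D
  set v := MeasureTheory.volume.real V
  set N := normK (L : K) with hNdef
  have key : Tendsto (fun T : ℝ => ((sieveSet ∅ L D V T).ncard : ℝ) * (N / T) ^ 2 * 4) atTop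
      (𝓝 (d * v)) := by
    rw [Metric.tendsto_nhds]
    intro ε hε
    obtain ⟨δ, hδ, h⟩ := exists_abs_ncard_sub_lt hD hV hε
    filter_upwards [eventually_gt_atTop 0, eventually_gt_atTop (|N| / δ)] with T hT0 hT
    have e : emb₁ (L : K) / T * emb₂ (L : K) = N / T := by
      rw [hNdef, normK_eq]; ring
    have := h (emb₁ (L : K) / T) (emb₂ (L : K)) (by rw [e]; exact div_ne_zero hN hT0.ne')
      (by
        rw [e, abs_div, abs_of_pos hT0, div_lt_iff₀ hT0]
        rwa [div_lt_iff₀ hδ, mul_comm] at hT)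
    rwa [← ncard_sieveSet_empty hL D V hT0.ne', e] at this
  have h2 := key.mul_const (1 / (4 * N ^ 2 * d))
  have e : d * v * (1 / (4 * N ^ 2 * d)) = v / (4 * N ^ 2) := by field_simp
  rw [e] at h2
  refine h2.congr' ?_
  filter_upwards [eventually_gt_atTop 0] with T hT
  rw [volume_real_smul]
  change _ = _ / (T ^ 2 * d)
  field_simp

theorem not_dvd_primes_of_ne {p q : primes} (h : p ≠ q) : ¬ (p : 𝓞 K) ∣ q := fun hd =>
  h (Subtype.ext (primes_eq_of_associated p.2 q.2 (p.2.1.associated_of_dvd q.2.1 hd)))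

-- One prime is sieved at a time: as `q ∤ L`, being divisible by `L` and `q` is being divisible by
-- `L q`, so the new count is the old one for `L` minus that for `L q`.
open Filter in
open Classical in
theorem tendsto_sieveSet (Q : Finset primes) {L : 𝓞 K} (hL : L ≠ 0)
    (hQ : ∀ q ∈ Q, ¬ (q : 𝓞 K) ∣ L) {D V : Set ℂ} (hD : JordanMeasurable D)
    (hD0 : 0 < MeasureTheory.volume D) (hV : JordanMeasurable V) :
    Tendsto (fun T : ℝ => ((sieveSet Q L D V T).ncard : ℝ) / MeasureTheory.volume.real (T • D))
      atTop (𝓝 (MeasureTheory.volume.real V / (4 * normK (L : K) ^ 2) *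
        ∏ q ∈ Q, (1 - 1 / normK ((q : 𝓞 K) : K) ^ 2))) := by
  induction Q using Finset.induction_on generalizing L with
  | empty => simpa using tendsto_sieveSet_empty hL hD hD0 hV
  | insert q Q hq ih =>
    have hqL : ¬ (q : 𝓞 K) ∣ L := hQ q (Finset.mem_insert_self _ _)
    have hQ' : ∀ p ∈ Q, ¬ (p : 𝓞 K) ∣ L := fun p hp => hQ p (Finset.mem_insert_of_mem hp)
    have hq0 : (q : 𝓞 K) ≠ 0 := q.2.1.ne_zero
    have h1 := ih hL hQ'
    have h2 := ih (L := L * q) (mul_ne_zero hL hq0) fun p hp hd =>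
      ((p.2.1.dvd_or_dvd hd).elim (hQ' p hp)
        (not_dvd_primes_of_ne fun h => hq (h ▸ hp)))
    have h3 := h1.sub h2
    have e : MeasureTheory.volume.real V / (4 * normK (L : K) ^ 2) *
          ∏ q ∈ Q, (1 - 1 / normK ((q : 𝓞 K) : K) ^ 2) -
        MeasureTheory.volume.real V / (4 * normK ((L * q : 𝓞 K) : K) ^ 2) *
          ∏ q ∈ Q, (1 - 1 / normK ((q : 𝓞 K) : K) ^ 2) =
        MeasureTheory.volume.real V / (4 * normK (L : K) ^ 2) *
          ∏ q ∈ insert q Q, (1 - 1 / normK ((q : 𝓞 K) : K) ^ 2) := by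
      have hN := normK_ne_zero (coe_ne_zero hL)
      have hN' := normK_ne_zero (coe_ne_zero hq0)
      rw [Finset.prod_insert hq, coe_mul, normK_mul]
      field_simp
    rw [e] at h3
    refine h3.congr fun T => ?_
    rw [← sub_div]
    congr 1
    have hdvd : ∀ x, L * q ∣ x ↔ L ∣ x ∧ (q : 𝓞 K) ∣ x := by
      intro x
      refine ⟨fun h => ⟨(dvd_mul_right _ _).trans h, (dvd_mul_left _ _).trans h⟩, ?_⟩
      rintro ⟨⟨y, rfl⟩, h⟩
      exact mul_dvd_mul_left L ((q.2.1.dvd_or_dvd h).resolve_left hqL)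
    have hunion : sieveSet Q L D V T = sieveSet (insert q Q) L D V T ∪
        sieveSet Q (L * q) D V T := by
      ext p
      simp only [sieveSet, Set.mem_union, Set.mem_ofPred_eq, hdvd, Finset.forall_mem_insert]
      tauto
    have hdisj : Disjoint (sieveSet (insert q Q) L D V T) (sieveSet Q (L * q) D V T) := by
      rw [Set.disjoint_left]
      rintro p ⟨-, h, -⟩ ⟨⟨h1, h2⟩, -⟩
      exact h q (Finset.mem_insert_self _ _) ⟨((hdvd _).mp h1).2, ((hdvd _).mp h2).2⟩
    rw [hunion, Set.ncard_union_eq hdisj (finite_sieveSet _ _ hD.1 hV.1 T)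
      (finite_sieveSet _ _ hD.1 hV.1 T)]
    push_cast
    ring

/-- The number of non-zero multiples of `L` is bounded uniformly in `L`. -/
theorem exists_ncard_multiples_le {D V : Set ℂ} (hD : Bornology.IsBounded D)
    (hV : Bornology.IsBounded V) :
    ∃ C : ℝ, 0 ≤ C ∧ ∀ L : 𝓞 K, L ≠ 0 → ∀ T : ℝ, 0 < T →
      ((sieveSet ∅ L D V T \ {0}).ncard : ℝ) ≤ C * T ^ 2 * (1 / normK (L : K) ^ 2) := by
  obtain ⟨R, hR⟩ := (Metric.isBounded_iff_subset_closedBall (0 : ℂ)).mp (hD.union hV)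
  obtain ⟨C, hC, h⟩ := exists_ncard_ptSet_le R
  refine ⟨C, hC, fun L hL T hT => ?_⟩
  have hN := normK_ne_zero (coe_ne_zero hL)
  have e : emb₁ (L : K) / T * emb₂ (L : K) = normK (L : K) / T := by
    rw [normK_eq]; ring
  have h1 := h (emb₁ (L : K) / T) (emb₂ (L : K)) (by rw [e]; exact div_ne_zero hN hT.ne')
  have hne : ∀ φ : K →+* ℝ, φ (L : K) ≠ 0 := fun φ => (map_ne_zero φ).mpr (coe_ne_zero hL)
  have h2 : (sieveSet ∅ L D V T \ {0}).ncard ≤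
      (ptSet (emb₁ (L : K) / T) (emb₂ (L : K)) (Metric.closedBall 0 R)
        (Metric.closedBall 0 R) \ {0}).ncard := by
    rw [← image_ptSet_mul D V hT.ne',
      ← Set.ncard_image_of_injective (ptSet _ _ _ _ \ {0}) (mul_pair_injective hL)]
    refine Set.ncard_le_ncard ?_ (((finite_ptSet (div_ne_zero (hne _) hT.ne') (hne _)
      Metric.isBounded_closedBall Metric.isBounded_closedBall).subset
        Set.sdiff_subset).image _)
    rintro _ ⟨⟨q, ⟨h1, h2⟩, rfl⟩, hq⟩
    refine ⟨q, ⟨⟨hR (Or.inl h1), hR (Or.inr h2)⟩, ?_⟩, rfl⟩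
    rintro rfl
    exact hq (by simp)
  have h2' : ((sieveSet ∅ L D V T \ {0}).ncard : ℝ) ≤ _ := Nat.cast_le.mpr h2
  refine h2'.trans ?_
  rw [e, div_pow] at h1
  rw [mul_one_div, le_div_iff₀ (by positivity)]
  rwa [mul_div_assoc', div_le_iff₀ (by positivity)] at h1

/-! ### The sets `A_W` in coordinates -/

theorem sqrt_two_eq_zeta8 : ((√2 : ℝ) : ℂ) = zeta8 - zeta8 ^ 3 := by
  rw [zeta8_cube, zeta8_eq]; push_cast; ring

theorem zeta8_pow_four : zeta8 ^ 4 = -1 := by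
  rw [show zeta8 ^ 4 = (zeta8 ^ 2) ^ 2 by ring, zeta8_sq, Complex.I_sq]

theorem zeta8_sq_eq : zeta8 ^ 2 = (√2 : ℝ) * zeta8 - 1 := by
  rw [sqrt_two_eq_zeta8]
  linear_combination zeta8_pow_four

theorem exists_Q8_pt (p : 𝓞 K × 𝓞 K) :
    ∃ y : Q8, (y : ℂ) = pt₁ p ∧ ((sigma8 y : Q8) : ℂ) = pt₂ p := by
  obtain ⟨α, β⟩ := p
  obtain ⟨a, b, rfl⟩ := exists_int_repr α
  obtain ⟨c, d, rfl⟩ := exists_int_repr β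
  have hz : (zetaGen : ℂ) = zeta8 := rfl
  refine ⟨a + b * (zetaGen - zetaGen ^ 3) + (c + d * (zetaGen - zetaGen ^ 3)) * zetaGen, ?_, ?_⟩
  · rw [pt₁, emb₁_int_repr, emb₁_int_repr]
    push_cast
    rw [hz, sqrt_two_eq_zeta8]
  · rw [pt₂, emb₂_int_repr, emb₂_int_repr]
    simp only [map_add, map_mul, map_sub, map_pow, map_intCast, sigma8_zeta]
    push_cast
    rw [hz, sqrt_two_eq_zeta8]
    have h9 : (zeta8 ^ 3) ^ 3 = zeta8 := by
      linear_combination (zeta8 ^ 5 - zeta8) * zeta8_pow_four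
    rw [h9]
    ring

theorem pt₁_mem_adjoin (p : 𝓞 K × 𝓞 K) : pt₁ p ∈ Algebra.adjoin ℤ {zeta8} := by
  obtain ⟨α, β⟩ := p
  obtain ⟨a, b, rfl⟩ := exists_int_repr α
  obtain ⟨c, d, rfl⟩ := exists_int_repr β
  have hz : zeta8 ∈ Algebra.adjoin ℤ {zeta8} := Algebra.self_mem_adjoin_singleton ℤ _
  have hs : zeta8 - zeta8 ^ 3 ∈ Algebra.adjoin ℤ {zeta8} := sub_mem hz (pow_mem hz 3)
  rw [pt₁, emb₁_int_repr, emb₁_int_repr]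
  push_cast
  rw [sqrt_two_eq_zeta8]
  exact add_mem (add_mem (intCast_mem _ _) (mul_mem (intCast_mem _ _) hs))
    (mul_mem (add_mem (intCast_mem _ _) (mul_mem (intCast_mem _ _) hs)) hz)

theorem exists_pt₁_eq {x : ℂ} (hx : x ∈ Algebra.adjoin ℤ {zeta8}) : ∃ p, pt₁ p = x := by
  induction hx using Algebra.adjoin_induction with
  | mem x hx =>
    rw [Set.mem_singleton_iff] at hx
    exact ⟨(0, 1), by simp [pt₁, hx]⟩
  | algebraMap n =>
    refine ⟨((n : 𝓞 K), 0), ?_⟩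
    simp [pt₁]
  | add x y _ _ hx hy =>
    obtain ⟨p, rfl⟩ := hx
    obtain ⟨q, rfl⟩ := hy
    refine ⟨p + q, ?_⟩
    simp only [pt₁, Prod.fst_add, Prod.snd_add, map_add]
    push_cast
    ring
  | mul x y _ _ hx hy =>
    obtain ⟨p, rfl⟩ := hx
    obtain ⟨q, rfl⟩ := hy
    refine ⟨(p.1 * q.1 - p.2 * q.2, p.1 * q.2 + p.2 * q.1 + sqrt2Int * p.2 * q.2), ?_⟩
    simp only [pt₁, map_add, map_sub, map_mul, coe_sqrt2Int, emb₁_sqrt2]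
    push_cast
    linear_combination (-(emb₁ (p.2 : K) : ℂ) * emb₁ (q.2 : K)) * zeta8_sq_eq

theorem mem_ASet {W : Set ℂ} {x : ℂ} : x ∈ ASet W ↔ ∃ p, pt₁ p = x ∧ pt₂ p ∈ W := by
  constructor
  · rintro ⟨hx, y, rfl, hy⟩
    obtain ⟨p, hp⟩ := exists_pt₁_eq hx
    obtain ⟨z, hz1, hz2⟩ := exists_Q8_pt p
    have : z = y := Subtype.ext (hz1.trans hp)
    rw [← this, hz2] at hy
    exact ⟨p, hp, hy⟩
  · rintro ⟨p, rfl, hp⟩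
    obtain ⟨z, hz1, hz2⟩ := exists_Q8_pt p
    exact ⟨pt₁_mem_adjoin p, z, hz1, hz2 ▸ hp⟩

theorem pt₁_mem_ASet {W : Set ℂ} {p : 𝓞 K × 𝓞 K} : pt₁ p ∈ ASet W ↔ pt₂ p ∈ W := by
  rw [mem_ASet]
  constructor
  · rintro ⟨q, hq, hqW⟩
    rwa [← pt₁_injective hq]
  · exact fun h => ⟨p, rfl, h⟩

theorem pt₁_eq_real_mul {p q : 𝓞 K × 𝓞 K} {t : ℝ} :
    pt₁ p = t * pt₁ q ↔ emb₁ (p.1 : K) = t * emb₁ (q.1 : K) ∧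
      emb₁ (p.2 : K) = t * emb₁ (q.2 : K) := by
  constructor
  · intro h
    have him := congrArg Complex.im h
    have hre := congrArg Complex.re h
    simp only [pt₁, Complex.add_im, Complex.add_re, Complex.ofReal_im, Complex.ofReal_re,
      Complex.mul_im, Complex.mul_re, zeta8_re, zeta8_im, zero_mul, add_zero, zero_add,
      sub_zero] at him hre
    have hs : (√2 / 2 : ℝ) ≠ 0 := by positivity
    have hb : emb₁ (p.2 : K) = t * emb₁ (q.2 : K) := by
      apply mul_right_cancel₀ hs
      linear_combination him
    refine ⟨?_, hb⟩
    rw [hb] at hre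
    linear_combination hre
  · rintro ⟨h1, h2⟩
    rw [pt₁, pt₁, h1, h2]
    push_cast
    ring

theorem pt₁_eq_mul {p q : 𝓞 K × 𝓞 K} {c : K} :
    pt₁ p = emb₁ c * pt₁ q ↔ (p.1 : K) = c * q.1 ∧ (p.2 : K) = c * q.2 := by
  rw [pt₁_eq_real_mul, ← map_mul, ← map_mul, emb₁_injective.eq_iff, emb₁_injective.eq_iff]

theorem pt₂_eq_mul {p q : 𝓞 K × 𝓞 K} {c : K} (h : pt₁ p = emb₁ c * pt₁ q) :
    pt₂ p = emb₂ c * pt₂ q := by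
  obtain ⟨h1, h2⟩ := pt₁_eq_mul.mp h
  rw [pt₂, pt₂, h1, h2, map_mul, map_mul]
  push_cast
  ring

/-- The ratio can be read off from a non-zero coordinate, so one point can occlude another only
through a quotient in `K`. -/
theorem exists_emb₁_eq {p q : 𝓞 K × 𝓞 K} (hq : q ≠ 0) {t : ℝ} (h : pt₁ p = t * pt₁ q) :
    ∃ c : K, emb₁ c = t := by
  obtain ⟨h1, h2⟩ := pt₁_eq_real_mul.mp h
  by_cases hq1 : q.1 = 0
  · have hq2 : q.2 ≠ 0 := fun h2 => hq (Prod.ext hq1 h2)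
    refine ⟨p.2 / q.2, ?_⟩
    rw [map_div₀, h2, mul_div_cancel_right₀ _ ((map_ne_zero emb₁).mpr (coe_ne_zero hq2))]
  · refine ⟨p.1 / q.1, ?_⟩
    rw [map_div₀, h1, mul_div_cancel_right₀ _ ((map_ne_zero emb₁).mpr (coe_ne_zero hq1))]

theorem div_mem_ASet_iff {W : Set ℂ} {p : 𝓞 K × 𝓞 K} {c : K} (hc : c ≠ 0) :
    pt₁ p / (emb₁ c : ℂ) ∈ ASet W ↔ ∃ q, pt₁ p = emb₁ c * pt₁ q ∧ pt₂ q ∈ W := by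
  have hc' : ((emb₁ c : ℝ) : ℂ) ≠ 0 := by
    rw [Complex.ofReal_ne_zero]; exact (map_ne_zero emb₁).mpr hc
  rw [mem_ASet]
  refine exists_congr fun q => and_congr_left fun _ => ?_
  rw [eq_div_iff hc', eq_comm, mul_comm]

theorem mem_smul_iff_of_pt₁_eq {W : Set ℂ} {p q : 𝓞 K × 𝓞 K} {c : K} (hc : c ≠ 0)
    (h : pt₁ p = emb₁ c * pt₁ q) : pt₂ p ∈ (emb₂ c) • W ↔ pt₂ q ∈ W := by
  have hc' : emb₂ c ≠ 0 := (map_ne_zero emb₂).mpr hc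
  rw [pt₂_eq_mul h, ← Complex.real_smul, Set.smul_mem_smul_set_iff₀ hc']

theorem exists_isNumerator (c : K) : ∃ a : 𝓞 K, IsNumerator c a :=
  ⟨IsFractionRing.num (𝓞 K) c, IsFractionRing.den (𝓞 K) c,
    nonZeroDivisors.ne_zero (IsFractionRing.den (𝓞 K) c).2,
    IsFractionRing.num_den_reduced (𝓞 K) c, (IsFractionRing.mk'_num_den' (𝓞 K) c).symm⟩

theorem IsNumerator.ne_zero {c : K} (hc : c ≠ 0) {a : 𝓞 K} (h : IsNumerator c a) : a ≠ 0 := by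
  rintro rfl
  obtain ⟨b, -, -, h⟩ := h
  rw [coe_zero, zero_div] at h
  exact hc h

/-- With `c = a / b` in lowest terms, `x / c = b x / a`, and `a` is prime to `b`. -/
theorem IsNumerator.dvd_iff {c : K} {a : 𝓞 K} (h : IsNumerator c a) (hc : c ≠ 0) (x : 𝓞 K) :
    a ∣ x ↔ ∃ y : 𝓞 K, (x : K) = c * y := by
  have ha := h.ne_zero hc
  obtain ⟨b, hb, hab, rfl⟩ := h
  have hb' := coe_ne_zero hb
  have ha' := coe_ne_zero ha
  constructor
  · rintro ⟨y, rfl⟩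
    refine ⟨b * y, ?_⟩
    rw [coe_mul, coe_mul]
    field_simp
  · rintro ⟨y, hy⟩
    have : b * x = a * y := by
      apply NumberField.RingOfIntegers.ext
      rw [coe_mul, coe_mul, hy]
      field_simp
    exact hab.dvd_of_dvd_mul_left ⟨y, this⟩

theorem IsNumerator.associated {c : K} {a a' : 𝓞 K} (hc : c ≠ 0) (h : IsNumerator c a)
    (h' : IsNumerator c a') : Associated a a' := by
  refine associated_of_dvd_dvd ?_ ?_
  · rw [h.dvd_iff hc, ← h'.dvd_iff hc]
  · rw [h'.dvd_iff hc, ← h.dvd_iff hc]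

/-- For `x ∈ ℤ[ζ]` and `c ∈ K`, the quotient `x / c` lies in `A_W` if and only if `x` is a multiple
of the numerator of `c` and `σ(x) ∈ σ(c) W`. -/
theorem div_mem_ASet_iff_dvd {W : Set ℂ} {p : 𝓞 K × 𝓞 K} {c : K} (hc : c ≠ 0) {a : 𝓞 K}
    (ha : IsNumerator c a) :
    pt₁ p / (emb₁ c : ℂ) ∈ ASet W ↔ (a ∣ p.1 ∧ a ∣ p.2) ∧ pt₂ p ∈ (emb₂ c) • W := by
  rw [div_mem_ASet_iff hc, ha.dvd_iff hc, ha.dvd_iff hc]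
  constructor
  · rintro ⟨q, h, hq⟩
    obtain ⟨h1, h2⟩ := pt₁_eq_mul.mp h
    exact ⟨⟨⟨q.1, h1⟩, ⟨q.2, h2⟩⟩, (mem_smul_iff_of_pt₁_eq hc h).mpr hq⟩
  · rintro ⟨⟨⟨x, hx⟩, ⟨y, hy⟩⟩, h⟩
    have e : pt₁ p = emb₁ c * pt₁ (x, y) := pt₁_eq_mul.mpr ⟨hx, hy⟩
    exact ⟨(x, y), e, (mem_smul_iff_of_pt₁_eq hc e).mp h⟩

theorem isNumerator_coe (a : 𝓞 K) : IsNumerator (a : K) a :=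
  ⟨1, one_ne_zero, isRelPrime_one_right, by rw [coe_one, div_one]⟩

/-- Division by a number with a large conjugate does not leave a star-shaped window. -/
theorem mem_smul_of_le_abs {W : Set ℂ} (hstar : StarConvex ℝ 0 W) {r : ℝ} (hr : 1 ≤ r)
    (hneg : -W ⊆ r • W) {s : ℝ} (hs : r ≤ |s|) {z : ℂ} (hz : z ∈ W) : z ∈ s • W := by
  have hs0 : s ≠ 0 := by
    rintro rfl
    rw [abs_zero] at hs
    linarith
  have hsmul : ∀ t : ℝ, 0 ≤ t → t ≤ 1 → ∀ w ∈ W, t • w ∈ W := fun t h0 h1 w hw =>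
    hstar.smul_mem hw h0 h1
  rw [Set.mem_smul_set_iff_inv_smul_mem₀ hs0]
  rcases lt_or_gt_of_ne hs0 with h | h
  · rw [abs_of_neg h] at hs
    obtain ⟨w, hw, hwz⟩ := hneg (Set.neg_mem_neg.mpr hz)
    have hz' : z = -(r • w) := by
      change r • w = -z at hwz
      rw [hwz, neg_neg]
    have e : s⁻¹ • z = (r / -s) • w := by
      rw [hz', smul_neg, smul_smul, ← neg_smul]
      congr 1
      rw [div_neg, div_eq_mul_inv, mul_comm]
    rw [e]
    exact hsmul _ (div_nonneg (by linarith) (by linarith))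
      ((div_le_one (by linarith)).mpr hs) _ hw
  · rw [abs_of_pos h] at hs
    exact hsmul _ (by positivity) (inv_le_one_of_one_le₀ (hr.trans hs)) _ hz

/-! ### Existence of a set of occlusion quotients -/

theorem mem_smallPrimes {r : ℝ} {p : 𝓞 K} :
    p ∈ smallPrimes r ↔ p ∈ primes ∧ |emb₂ (p : K)| ≤ r := by
  rw [smallPrimes, Set.Finite.mem_toFinset]
  rfl

theorem exists_eq_unit_mul_prod (r : ℝ) {g : 𝓞 K} (hg : g ≠ 0)
    (h : ∀ p ∈ primes, p ∣ g → p ∈ smallPrimes r) :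
    ∃ (u : (𝓞 K)ˣ) (f : smallPrimes r → ℕ), g = u * ∏ p : smallPrimes r, (p : 𝓞 K) ^ f p := by
  classical
  induction g using UniqueFactorizationMonoid.induction_on_prime with
  | h₁ => exact absurd rfl hg
  | h₂ x hx => exact ⟨hx.unit, 0, by simp⟩
  | h₃ a q ha hq ih =>
    obtain ⟨u, f, hf⟩ := ih ha fun p hp hpa => h p hp (hpa.mul_left q)
    obtain ⟨p, hp, v, hv⟩ := exists_mem_primes_associated hq
    have hps : p ∈ smallPrimes r := h p hp ((Dvd.intro _ hv).mul_right a)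
    refine ⟨v * u, f + Pi.single ⟨p, hps⟩ 1, ?_⟩
    have hsingle : ∏ i : smallPrimes r,
        (i : 𝓞 K) ^ ((Pi.single ⟨p, hps⟩ 1 : smallPrimes r → ℕ) i) = p := by
      rw [Finset.prod_eq_single ⟨p, hps⟩]
      · simp
      · intro b _ hb
        simp [Pi.single_eq_of_ne hb]
      · simp
    simp only [Pi.add_apply, pow_add, Finset.prod_mul_distrib, hsingle]
    rw [hf, ← hv, Units.val_mul]
    ring

/-- Greatest common divisors scale with the pair: `gcd p = c * gcd q` up to a unit, which is
absorbed into `g`. The prime factors of `c` are thus controlled by common divisors of the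
coordinates of `p` and of `q`. -/
theorem exists_content_ratio {p q : 𝓞 K × 𝓞 K} (hp : p ≠ 0) {c : K}
    (h1 : (p.1 : K) = c * q.1) (h2 : (p.2 : K) = c * q.2) :
    ∃ g h : 𝓞 K, g ≠ 0 ∧ h ≠ 0 ∧ (∀ x, x ∣ g → x ∣ p.1 ∧ x ∣ p.2) ∧
      (∀ x, x ∣ h → x ∣ q.1 ∧ x ∣ q.2) ∧ (g : K) = c * h := by
  classical
  let _ := UniqueFactorizationMonoid.toGCDMonoid (𝓞 K)
  have hc : c ≠ 0 := by
    rintro rfl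
    rw [zero_mul] at h1 h2
    exact hp (Prod.ext (NumberField.RingOfIntegers.ext h1) (NumberField.RingOfIntegers.ext h2))
  have hgcd : ∀ p : 𝓞 K × 𝓞 K, p ≠ 0 → gcd p.1 p.2 ≠ 0 := by
    intro p hp h
    rw [gcd_eq_zero_iff] at h
    exact hp (Prod.ext h.1 h.2)
  have hq : q ≠ 0 := by
    rintro rfl
    exact hp (Prod.ext (NumberField.RingOfIntegers.ext (by simpa using h1))
      (NumberField.RingOfIntegers.ext (by simpa using h2)))
  obtain ⟨a, b, hb, -, rfl⟩ := exists_isNumerator c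
  have hb' := coe_ne_zero hb
  have e1 : b * p.1 = a * q.1 := by
    apply NumberField.RingOfIntegers.ext
    rw [coe_mul, coe_mul, h1]; field_simp
  have e2 : b * p.2 = a * q.2 := by
    apply NumberField.RingOfIntegers.ext
    rw [coe_mul, coe_mul, h2]; field_simp
  have A1 := gcd_mul_left' b p.1 p.2
  have A2 := gcd_mul_left' a q.1 q.2
  rw [e1, e2] at A1
  obtain ⟨u, hu⟩ := A1.symm.trans A2
  refine ⟨gcd p.1 p.2 * u, gcd q.1 q.2, mul_ne_zero (hgcd p hp) u.ne_zero, hgcd q hq,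
    fun x hx => ?_, fun x hx => ⟨hx.trans (gcd_dvd_left _ _), hx.trans (gcd_dvd_right _ _)⟩, ?_⟩
  · have hx' : x ∣ gcd p.1 p.2 := Units.dvd_mul_right.mp hx
    exact ⟨hx'.trans (gcd_dvd_left _ _), hx'.trans (gcd_dvd_right _ _)⟩
  · have := congrArg (fun x : 𝓞 K => (x : K)) hu
    simp only [coe_mul] at this
    rw [coe_mul]
    field_simp
    linear_combination this

/-- The elements `∏ π ^ (e_π)` of `K`. -/
def primeProd (r : ℝ) (e : smallPrimes r → ℤ) : K := ∏ p : smallPrimes r, ((p : 𝓞 K) : K) ^ e p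

theorem smallPrimes_pos {r : ℝ} (p : smallPrimes r) : 0 < emb₁ ((p : 𝓞 K) : K) :=
  primes_pos (mem_smallPrimes.mp p.2).1

theorem smallPrimes_ne_zero {r : ℝ} (p : smallPrimes r) : ((p : 𝓞 K) : K) ≠ 0 := fun h => by
  have := smallPrimes_pos p
  rw [h, map_zero] at this
  exact this.false

theorem primeProd_pos {r : ℝ} (e : smallPrimes r → ℤ) : 0 < emb₁ (primeProd r e) := by
  rw [primeProd, map_prod]
  refine Finset.prod_pos fun p _ => ?_
  rw [map_zpow₀]
  exact zpow_pos (smallPrimes_pos p) _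

theorem zpow_lam_mul_mem_quotientSet {r : ℝ} {k₀ k₁ k : ℤ} {m e : smallPrimes r → ℤ}
    (hk₀ : k₀ ≤ k) (hk₁ : k ≤ k₁) (he : ∀ p, -(m p) < e p ∧ e p < m p)
    (h : 1 < emb₁ (lam ^ k * primeProd r e)) :
    lam ^ k * primeProd r e ∈ quotientSet r k₀ k₁ m := by
  classical
  refine Finset.mem_union_right _
    (Finset.mem_filter.mpr ⟨Finset.mem_image.mpr ⟨(k, e), ?_, rfl⟩, h⟩)
  rw [Finset.mem_product, Finset.mem_Icc, Fintype.mem_piFinset]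
  exact ⟨⟨hk₀, hk₁⟩, fun p => Finset.mem_Ioo.mpr (he p)⟩

theorem zpow_mem_quotientSet {r : ℝ} (k₀ k₁ : ℤ) (m : smallPrimes r → ℤ) (p : smallPrimes r) :
    ((p : 𝓞 K) : K) ^ m p ∈ quotientSet r k₀ k₁ m := by
  classical
  exact Finset.mem_union_left _ (Finset.mem_image.mpr ⟨p, Finset.mem_univ _, rfl⟩)

theorem mem_candidateSet {r : ℝ} {M : Finset K} {c : ℝ} :
    c ∈ candidateSet r M ↔ (∃ p ∈ primes, p ∉ smallPrimes r ∧ c = emb₁ (p : K)) ∨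
      ∃ x ∈ M, c = emb₁ x := Iff.rfl

/-- Among the quotients `x / s` in `A_W`, `s > 1`, of an invisible point `x ≠ 0` there is one
from which no divisor `L > 1` with a large conjugate can be split off. -/
theorem exists_minimal_quotient {W : Set ℂ} (hW : Bornology.IsBounded W)
    (hstar : StarConvex ℝ 0 W) {r : ℝ} (hr : 1 ≤ r) (hneg : -W ⊆ r • W) {p q₀ : 𝓞 K × 𝓞 K}
    (hp : p ≠ 0) {t : ℝ} (ht : 1 < t) (hq₀ : pt₁ p = t * pt₁ q₀) (hq₀W : pt₂ q₀ ∈ W) :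
    ∃ (q : 𝓞 K × 𝓞 K) (c : K), 1 < emb₁ c ∧ pt₁ p = emb₁ c * pt₁ q ∧ pt₂ q ∈ W ∧
      ∀ L : 𝓞 K, 1 < emb₁ (L : K) → r ≤ |emb₂ (L : K)| → ¬ (L ∣ q.1 ∧ L ∣ q.2) := by
  set Y : Set (𝓞 K × 𝓞 K) := {q | pt₂ q ∈ W ∧ ∃ s : ℝ, 1 < s ∧ pt₁ p = s * pt₁ q} with hY
  -- Occluding points have modulus at most `‖pt₁ p‖` and conjugates in the bounded set `W`, so there
  -- are finitely many and a closest one exists.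
  have hfin : Y.Finite := by
    refine (finite_ptSet one_ne_zero one_ne_zero
      (Metric.isBounded_closedBall (x := (0 : ℂ)) (r := ‖pt₁ p‖)) hW).subset ?_
    rintro q ⟨hqW, s, hs, h⟩
    refine ⟨?_, by simpa using hqW⟩
    rw [Complex.ofReal_one, one_mul, mem_closedBall_zero_iff, h, norm_mul, Complex.norm_real,
      Real.norm_of_nonneg (by linarith)]
    exact le_mul_of_one_le_left (norm_nonneg _) hs.le
  obtain ⟨q, ⟨hqW, s, hs, h⟩, hmin⟩ :=
    Set.exists_min_image Y (fun q => ‖pt₁ q‖) hfin ⟨q₀, hq₀W, t, ht, hq₀⟩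
  have hpp : pt₁ p ≠ 0 := fun h => hp (pt₁_injective (h.trans pt₁_zero.symm))
  have hqq : pt₁ q ≠ 0 := fun h' => hpp (by rw [h, h', mul_zero])
  have hq0 : q ≠ 0 := fun h' => hqq (by rw [h', pt₁_zero])
  obtain ⟨c, rfl⟩ := exists_emb₁_eq hq0 h
  refine ⟨q, c, hs, h, hqW, fun L hL1 hLr hLd => ?_⟩
  obtain ⟨⟨a, ha⟩, ⟨b, hb⟩⟩ := hLd
  have hqL : q = (L * (a, b).1, L * (a, b).2) := Prod.ext ha hb
  have hL0 : L ≠ 0 := by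
    rintro rfl
    rw [coe_zero, map_zero] at hL1
    linarith
  have e1 : pt₁ q = emb₁ (L : K) * pt₁ (a, b) := by rw [hqL, pt₁_mul]
  -- If `L` divided `q`, then `q / L` would stay in the window because `|σ(L)| ≥ r`, and would be
  -- closer to the origin than the minimal `q`.
  have hmem : (a, b) ∈ Y := by
    refine ⟨(mem_smul_iff_of_pt₁_eq (coe_ne_zero hL0) e1).mp
      (mem_smul_of_le_abs hstar hr hneg hLr hqW), emb₁ c * emb₁ (L : K), ?_, ?_⟩
    · nlinarith
    · rw [h, e1]; push_cast; ring
  have h3 := hmin _ hmem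
  have h4 : 0 < ‖pt₁ (a, b)‖ := by
    rw [norm_pos_iff]
    rintro h0
    rw [e1, h0, mul_zero] at hqq
    exact hqq rfl
  rw [e1, norm_mul, Complex.norm_real, Real.norm_of_nonneg (by linarith)] at h3
  nlinarith

/-- The conjugate of `λ²` is `(1 - √2)²`, in `(0, 1)`, so star-shapedness absorbs it. An odd power
of `λ` would reverse the sign. -/
theorem pt₂_lam_sq_mul_mem {W : Set ℂ} (hstar : StarConvex ℝ 0 W) {q : 𝓞 K × 𝓞 K}
    (hq : pt₂ q ∈ W) (i : ℕ) : ∃ q', pt₁ q' = emb₁ (lam ^ (2 * i)) * pt₁ q ∧ pt₂ q' ∈ W := by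
  refine ⟨((lamUnit : 𝓞 K) ^ (2 * i) * q.1, (lamUnit : 𝓞 K) ^ (2 * i) * q.2), ?_, ?_⟩
  · rw [pt₁_mul, coe_pow, coe_lamUnit]
  · rw [pt₂_mul, coe_pow, coe_lamUnit, map_pow, ← Complex.real_smul]
    refine hstar.smul_mem hq ?_ ?_
    · rw [pow_mul]; positivity
    · rw [pow_mul]
      refine pow_le_one₀ (sq_nonneg _) ?_
      rw [emb₂_lam]
      nlinarith [sqrt_two_gt, sqrt_two_lt]

theorem exists_isOcclusionQuotients {W : Set ℂ} (hW : Bornology.IsBounded W)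
    (hstar : StarConvex ℝ 0 W) (hnhds : W ∈ 𝓝 (0 : ℂ)) {r : ℝ} (hr : 1 ≤ r)
    (hneg : -W ⊆ r • W) :
    ∃ (k₀ k₁ : ℤ) (m : smallPrimes r → ℤ), k₀ ≤ 0 ∧
      IsOcclusionQuotients (ASet W) (candidateSet r (quotientSet r k₀ k₁ m)) := by
  classical
  have hl := one_lt_emb₁_lam
  have hl0 : 0 < emb₁ lam := by linarith
  have hn : ∀ p : smallPrimes r, ∃ n : ℕ, r ≤ |emb₂ ((p : 𝓞 K) : K)| ^ n := fun p =>
    (pow_unbounded_of_one_lt r (one_lt_abs_emb₂ (mem_primes.mp (mem_smallPrimes.mp p.2).1).2.1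
      (mem_primes.mp (mem_smallPrimes.mp p.2).1).2.2)).imp fun _ h => h.le
  choose n hn using hn
  -- The extra 1 keeps every `m p` positive even when `n p = 0`, so that `π ^ m > 1` and the
  -- exponent 0 is admissible.
  set m : smallPrimes r → ℤ := fun p => ((n p + 1 : ℕ) : ℤ) with hm
  have hnr : ∀ p : smallPrimes r, r ≤ |emb₂ ((((p : 𝓞 K) ^ (n p + 1) : 𝓞 K)) : K)| := by
    intro p
    rw [coe_pow, map_pow, abs_pow]
    refine (hn p).trans (pow_le_pow_right₀ ?_ (Nat.le_succ _))
    exact (one_lt_abs_emb₂ (mem_primes.mp (mem_smallPrimes.mp p.2).1).2.1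
      (mem_primes.mp (mem_smallPrimes.mp p.2).1).2.2).le
  have hone : ∀ p : smallPrimes r, 1 < emb₁ ((((p : 𝓞 K) ^ (n p + 1) : 𝓞 K)) : K) := by
    intro p
    rw [coe_pow, map_pow]
    exact one_lt_pow₀ (mem_primes.mp (mem_smallPrimes.mp p.2).1).2.1 (Nat.succ_ne_zero _)
  have hzpow : ∀ p : smallPrimes r, (((p : 𝓞 K) : K)) ^ m p =
      ((((p : 𝓞 K) ^ (n p + 1) : 𝓞 K)) : K) := by
    intro p
    rw [coe_pow, hm, zpow_natCast]
  -- The integer `κ e` is the threshold for the power of `λ`: larger exponents give elements above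
  -- 1, smaller ones do not.
  have hκ : ∀ e : smallPrimes r → ℤ, ∃ k : ℤ, 1 ≤ emb₁ (lam ^ k * primeProd r e) ∧
      emb₁ (lam ^ k * primeProd r e) < emb₁ lam := fun e => exists_lam_zpow_mul (primeProd_pos e)
  choose κ hκ1 hκ2 using hκ
  have hup : ∀ e k, κ e < k → 1 < emb₁ (lam ^ k * primeProd r e) := by
    intro e k hk
    refine (hκ1 e).trans_lt ?_
    rw [map_mul, map_mul, map_zpow₀, map_zpow₀]
    exact mul_lt_mul_of_pos_right (zpow_lt_zpow_right₀ hl hk) (primeProd_pos e)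
  have hdown : ∀ e k, k < κ e → ¬ 1 < emb₁ (lam ^ k * primeProd r e) := by
    intro e k hk h
    have h2 := hκ2 e
    rw [map_mul, map_zpow₀] at h h2
    have h3 : emb₁ lam ^ (k + 1) ≤ emb₁ lam ^ κ e := zpow_le_zpow_right₀ hl.le (by omega)
    rw [zpow_add_one₀ hl0.ne'] at h3
    have h4 := mul_le_mul_of_nonneg_right h3 (primeProd_pos e).le
    nlinarith
  set E : Finset (smallPrimes r → ℤ) :=
    Fintype.piFinset (fun p => Finset.Ioo (-(m p)) (m p)) with hE
  obtain ⟨A, hA⟩ := Finset.exists_le (E.image κ)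
  obtain ⟨B, hB⟩ := Finset.exists_le ((E.image κ).image (fun k => -k))
  replace hA : ∀ e ∈ E, κ e ≤ A := fun e he => hA _ (Finset.mem_image_of_mem _ he)
  replace hB : ∀ e ∈ E, -B ≤ κ e := fun e he => by
    have := hB _ (Finset.mem_image_of_mem _ (Finset.mem_image_of_mem κ he))
    omega
  -- The lower end lies below every threshold `κ e`. The upper end exceeds them all by 2, so an even
  -- shift from above lands in range and strictly above the threshold; the 1 ensures that `λ` itself
  -- is available.
  refine ⟨min (-B) 0, max (A + 2) 1, m, min_le_right _ _, ?_, ?_⟩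
  · rintro c hc
    rcases mem_candidateSet.mp hc with ⟨p, hp, -, rfl⟩ | ⟨x, hx, rfl⟩
    · exact (mem_primes.mp hp).2.1
    · rcases Finset.mem_union.mp hx with hx | hx
      · obtain ⟨p, -, rfl⟩ := Finset.mem_image.mp hx
        rw [hzpow]
        exact hone p
      · exact (Finset.mem_filter.mp hx).2
  · rintro x ⟨hx, hxv⟩
    obtain ⟨p, rfl, hpW⟩ := mem_ASet.mp hx
    have hmE : ∀ e, e ∈ E ↔ ∀ p, -(m p) < e p ∧ e p < m p := by
      intro e
      rw [hE, Fintype.mem_piFinset]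
      simp only [Finset.mem_Ioo]
    by_cases hp0 : p = 0
    -- The origin is fixed by every division, so any element of the set serves as a quotient; `λ` is
    -- one.
    · refine ⟨emb₁ (lam ^ (1 : ℤ) * primeProd r 0), mem_candidateSet.mpr (Or.inr ⟨_,
        zpow_lam_mul_mem_quotientSet ((min_le_right _ _).trans zero_le_one) (le_max_right _ _)
          (fun p => ?_) ?_, rfl⟩), ?_⟩
      · simp [hm]; omega
      · simpa [primeProd] using hl
      · rw [hp0, pt₁_zero, zero_div, ← pt₁_zero, pt₁_mem_ASet, pt₂_zero]
        exact mem_of_mem_nhds hnhds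
    obtain ⟨t, ht0, ht1, htx⟩ : ∃ t : ℝ, 0 < t ∧ t < 1 ∧ (t : ℂ) * pt₁ p ∈ ASet W := by
      by_contra hcon
      push Not at hcon
      exact hxv ⟨hx, hcon⟩
    obtain ⟨q₀, hq₀, hq₀W⟩ := mem_ASet.mp htx
    have hq₀' : pt₁ p = (t⁻¹ : ℝ) * pt₁ q₀ := by
      rw [hq₀, ← mul_assoc, ← Complex.ofReal_mul, inv_mul_cancel₀ ht0.ne', Complex.ofReal_one,
        one_mul]
    obtain ⟨q, c, hc1, hpq, hqW, hmin⟩ := exists_minimal_quotient hW hstar hr hneg hp0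
      ((one_lt_inv₀ ht0).mpr ht1) hq₀' hq₀W
    have hlarge : ∀ L : 𝓞 K, L ≠ 0 → r ≤ |emb₂ (L : K)| → L ∣ p.1 ∧ L ∣ p.2 →
        pt₁ p / (emb₁ (L : K) : ℂ) ∈ ASet W := fun L hL hLr hLd =>
      (div_mem_ASet_iff_dvd (coe_ne_zero hL) (isNumerator_coe L)).mpr
        ⟨hLd, mem_smul_of_le_abs hstar hr hneg hLr hpW⟩
    by_cases h1 : ∃ π ∈ primes, π ∉ smallPrimes r ∧ π ∣ p.1 ∧ π ∣ p.2
    · obtain ⟨π, hπ, hπr, hd⟩ := h1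
      refine ⟨_, mem_candidateSet.mpr (Or.inl ⟨π, hπ, hπr, rfl⟩), hlarge π hπ.1.ne_zero ?_ hd⟩
      by_contra! hlt
      exact hπr (mem_smallPrimes.mpr ⟨hπ, hlt.le⟩)
    by_cases h2 : ∃ π : smallPrimes r,
        (π : 𝓞 K) ^ (n π + 1) ∣ p.1 ∧ (π : 𝓞 K) ^ (n π + 1) ∣ p.2
    · obtain ⟨π, hd⟩ := h2
      refine ⟨_, mem_candidateSet.mpr (Or.inr ⟨_, zpow_mem_quotientSet _ _ m π, rfl⟩), ?_⟩
      rw [hzpow]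
      exact hlarge _ (pow_ne_zero _ (mem_smallPrimes.mp π.2).1.1.ne_zero) (hnr π) hd
    obtain ⟨hc_1, hc_2⟩ := pt₁_eq_mul.mp hpq
    obtain ⟨g, h, hg0, hh0, hgd, hhd, hgh⟩ := exists_content_ratio hp0 hc_1 hc_2
    -- The content `g` of `p` involves only primes of `P` because the first case failed, and the
    -- content `h` of `q` because `q` is minimal. The same two sources bound their exponents by `n
    -- π`.
    obtain ⟨u, f, hf⟩ := exists_eq_unit_mul_prod r hg0 fun π hπ hd => by
      by_contra hcon
      exact h1 ⟨π, hπ, hcon, hgd _ hd⟩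
    obtain ⟨v, f', hf'⟩ := exists_eq_unit_mul_prod r hh0 fun π hπ hd => by
      by_contra hcon
      refine hmin π (mem_primes.mp hπ).2.1 ?_ (hhd _ hd)
      by_contra! hlt
      exact hcon (mem_smallPrimes.mpr ⟨hπ, hlt.le⟩)
    have hfm : ∀ π, f π < n π + 1 := by
      intro π
      by_contra! hle
      refine h2 ⟨π, hgd _ ?_⟩
      rw [hf]
      exact ((pow_dvd_pow _ hle).trans
        (Finset.dvd_prod_of_mem (fun p : smallPrimes r => (p : 𝓞 K) ^ f p)
          (Finset.mem_univ π))).mul_left _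
    have hfm' : ∀ π, f' π < n π + 1 := by
      intro π
      by_contra! hle
      refine hmin _ (hone π) (hnr π) (hhd _ ?_)
      rw [hf']
      exact ((pow_dvd_pow _ hle).trans
        (Finset.dvd_prod_of_mem (fun p : smallPrimes r => (p : 𝓞 K) ^ f' p)
          (Finset.mem_univ π))).mul_left _
    set e : smallPrimes r → ℤ := fun π => (f π : ℤ) - f' π with he
    have heE : e ∈ E := by
      rw [hmE]
      intro π
      have := hfm π
      have := hfm' π
      simp only [he, hm]
      omega
    have hcu : c = ((u * v⁻¹ : (𝓞 K)ˣ) : 𝓞 K) * primeProd r e := by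
      have hvK : ((v : 𝓞 K) : K) * (((v⁻¹ : (𝓞 K)ˣ) : 𝓞 K) : K) = 1 := by
        rw [← coe_mul, Units.mul_inv, coe_one]
      have e1 : primeProd r e * ((∏ p : smallPrimes r, (p : 𝓞 K) ^ f' p : 𝓞 K) : K) =
          ((∏ p : smallPrimes r, (p : 𝓞 K) ^ f p : 𝓞 K) : K) := by
        rw [coe_prod, coe_prod, primeProd, ← Finset.prod_mul_distrib]
        refine Finset.prod_congr rfl fun π _ => ?_
        rw [coe_pow, coe_pow, ← zpow_natCast, ← zpow_natCast,
          ← zpow_add₀ (smallPrimes_ne_zero π), he]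
        congr 1
        ring
      have hne : ((∏ p : smallPrimes r, (p : 𝓞 K) ^ f' p : 𝓞 K) : K) ≠ 0 := by
        intro h0
        apply coe_ne_zero hh0
        rw [hf', coe_mul, h0, mul_zero]
      rw [hf, hf', coe_mul, coe_mul, ← e1] at hgh
      rw [Units.val_mul, coe_mul]
      apply mul_right_cancel₀ hne
      linear_combination (-(((v⁻¹ : (𝓞 K)ˣ) : 𝓞 K) : K)) * hgh -
        c * ((∏ p : smallPrimes r, (p : 𝓞 K) ^ f' p : 𝓞 K) : K) * hvK
    obtain ⟨k, hk⟩ := unit_eq_lam_zpow (u := u * v⁻¹) (by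
      have := hc1
      rw [hcu, map_mul] at this
      exact pos_of_mul_pos_left (by linarith) (primeProd_pos e).le)
    rw [hk] at hcu
    have hk0 : κ e ≤ k := by
      by_contra! hlt
      rw [hcu] at hc1
      exact hdown e k hlt hc1
    have hAe := hA e heE
    have hBe := hB e heE
    -- An exponent `k` that is too large is lowered by the least `2 * i` reaching the upper end. The
    -- quotient then becomes `λ ^ (2 * i) q`, which remains in `A_W`.
    obtain ⟨i, hi1, hi2, hi3⟩ : ∃ i : ℕ, min (-B) 0 ≤ k - 2 * i ∧ k - 2 * i ≤ max (A + 2) 1 ∧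
        (i = 0 ∨ κ e < k - 2 * i) := by
      by_cases hk1 : k ≤ max (A + 2) 1
      · exact ⟨0, by simp; omega, by simpa using hk1, Or.inl rfl⟩
      · refine ⟨((k - max (A + 2) 1 + 1) / 2).toNat, ?_, ?_, Or.inr ?_⟩ <;> omega
    have hgt : 1 < emb₁ (lam ^ (k - 2 * i) * primeProd r e) := by
      rcases hi3 with rfl | hi3
      · simpa [← hcu] using hc1
      · exact hup _ _ hi3
    refine ⟨_, mem_candidateSet.mpr (Or.inr ⟨_,
      zpow_lam_mul_mem_quotientSet hi1 hi2 ((hmE e).mp heE) hgt, rfl⟩), ?_⟩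
    obtain ⟨q', hq'1, hq'W⟩ := pt₂_lam_sq_mul_mem hstar hqW i
    refine (div_mem_ASet_iff fun h0 => ?_).mpr ⟨q', ?_, hq'W⟩
    · rw [h0, map_zero] at hgt
      linarith
    · rw [hq'1, ← mul_assoc, ← Complex.ofReal_mul, ← map_mul, hpq, hcu]
      congr 3
      rw [mul_right_comm, ← zpow_natCast, ← zpow_add₀ lam_ne_zero]
      push_cast
      rw [sub_add_cancel]

/-! ### Numerators and least common multiples -/

/-- `c` is a quotient of two algebraic integers not divisible by `q`. -/
def IsLocalUnit (q : 𝓞 K) (c : K) : Prop :=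
  ∃ s t : 𝓞 K, ¬ q ∣ s ∧ ¬ q ∣ t ∧ c * t = s

theorem IsLocalUnit.mul {q : 𝓞 K} (hq : Prime q) {c d : K} (hc : IsLocalUnit q c)
    (hd : IsLocalUnit q d) : IsLocalUnit q (c * d) := by
  obtain ⟨s, t, hs, ht, h⟩ := hc
  obtain ⟨s', t', hs', ht', h'⟩ := hd
  refine ⟨s * s', t * t', fun h => (hq.dvd_or_dvd h).elim hs hs',
    fun h => (hq.dvd_or_dvd h).elim ht ht', ?_⟩
  rw [coe_mul, coe_mul, ← h, ← h']
  ring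

theorem IsLocalUnit.inv {q : 𝓞 K} {c : K} (hc : IsLocalUnit q c) : IsLocalUnit q c⁻¹ := by
  obtain ⟨s, t, hs, ht, h⟩ := hc
  refine ⟨t, s, ht, hs, ?_⟩
  have hs0 : (s : K) ≠ 0 := coe_ne_zero fun h0 => hs (h0 ▸ dvd_zero q)
  have hc0 : c ≠ 0 := by
    rintro rfl
    rw [zero_mul] at h
    exact hs0 h.symm
  rw [← h, inv_mul_cancel_left₀ hc0]

theorem isLocalUnit_coe {q : 𝓞 K} (hq : Prime q) {x : 𝓞 K} (hx : ¬ q ∣ x) :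
    IsLocalUnit q (x : K) :=
  ⟨x, 1, hx, fun h => hq.not_isUnit (isUnit_of_dvd_one h), by rw [coe_one, mul_one]⟩

theorem isLocalUnit_one {q : 𝓞 K} (hq : Prime q) : IsLocalUnit q 1 := by
  rw [← coe_one]
  exact isLocalUnit_coe hq fun h => hq.not_isUnit (isUnit_of_dvd_one h)

theorem IsLocalUnit.zpow {q : 𝓞 K} (hq : Prime q) {c : K} (hc : IsLocalUnit q c) (k : ℤ) :
    IsLocalUnit q (c ^ k) := by
  have hpow : ∀ n : ℕ, IsLocalUnit q (c ^ n) := fun n => by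
    induction n with
    | zero => rw [pow_zero]; exact isLocalUnit_one hq
    | succ n ih => rw [pow_succ]; exact ih.mul hq hc
  obtain ⟨n, rfl | rfl⟩ := k.eq_nat_or_neg
  · rw [zpow_natCast]; exact hpow n
  · rw [zpow_neg, zpow_natCast]; exact (hpow n).inv

theorem not_dvd_smallPrimes {r : ℝ} {q : 𝓞 K} (hq : q ∈ primes) (hqr : q ∉ smallPrimes r)
    (p : smallPrimes r) : ¬ q ∣ (p : 𝓞 K) := fun h => by
  have hp := (mem_smallPrimes.mp p.2).1
  rw [primes_eq_of_associated hq hp (hq.1.associated_of_dvd hp.1 h)] at hqr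
  exact hqr p.2

/-- Only `λ` and primes of `P` enter such an element. Hence the conditions from `M` and from primes
outside `P` can be sieved independently. -/
theorem isLocalUnit_of_mem_quotientSet {r : ℝ} {k₀ k₁ : ℤ} {m : smallPrimes r → ℤ} {c : K}
    (hc : c ∈ quotientSet r k₀ k₁ m) {q : 𝓞 K} (hq : q ∈ primes) (hqr : q ∉ smallPrimes r) :
    IsLocalUnit q c := by
  classical
  have hp : ∀ p : smallPrimes r, IsLocalUnit q ((p : 𝓞 K) : K) := fun p =>
    isLocalUnit_coe hq.1 (not_dvd_smallPrimes hq hqr p)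
  have hlam : IsLocalUnit q lam := by
    rw [← coe_lamUnit]
    exact isLocalUnit_coe hq.1 fun h => hq.1.not_isUnit (isUnit_of_dvd_unit h lamUnit.isUnit)
  rcases Finset.mem_union.mp hc with hc | hc
  · obtain ⟨p, -, rfl⟩ := Finset.mem_image.mp hc
    exact (hp p).zpow hq.1 _
  · obtain ⟨⟨k, e⟩, -, rfl⟩ := Finset.mem_image.mp (Finset.mem_filter.mp hc).1
    refine (hlam.zpow hq.1 k).mul hq.1 ?_
    exact Finset.prod_induction _ _ (fun _ _ h h' => h.mul hq.1 h') (isLocalUnit_one hq.1)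
      fun p _ => (hp p).zpow hq.1 _

theorem IsLocalUnit.not_dvd {q : 𝓞 K} (hq : Prime q) {c : K} (hc : IsLocalUnit q c) {a : 𝓞 K}
    (ha : IsNumerator c a) : ¬ q ∣ a := by
  intro hqa
  obtain ⟨s, t, hs, ht, h⟩ := hc
  obtain ⟨b, hb, hab, rfl⟩ := ha
  have hb' := coe_ne_zero hb
  have e : a * t = b * s := by
    apply NumberField.RingOfIntegers.ext
    rw [coe_mul, coe_mul, ← h]
    field_simp
  have hqb : q ∣ b := (hq.dvd_or_dvd (e ▸ hqa.mul_right t)).resolve_right hs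
  exact hq.not_isUnit (hab hqa hqb)

/-- A generator of the intersection of the principal ideals of all numerators, which exists in a
principal ideal domain. -/
theorem exists_isLcmOfNumerators (S : Finset K) : ∃ L, IsLcmOfNumerators S L := by
  obtain ⟨L, hL⟩ := (IsPrincipalIdealRing.principal
    (⨅ c ∈ S, ⨅ a : 𝓞 K, ⨅ _ : IsNumerator c a, Ideal.span {a} : Ideal (𝓞 K))).principal
  refine ⟨L, fun y => ?_⟩
  rw [← Ideal.mem_span_singleton, ← Ideal.submodule_span_eq, ← hL]
  simp only [Submodule.mem_iInf, Ideal.mem_span_singleton]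

theorem IsLcmOfNumerators.dvd_iff {S : Finset K} {L : 𝓞 K} (hL : IsLcmOfNumerators S L)
    (hS : ∀ c ∈ S, c ≠ 0) {num : K → 𝓞 K} (hnum : ∀ c, IsNumerator c (num c)) (y : 𝓞 K) :
    L ∣ y ↔ ∀ c ∈ S, num c ∣ y := by
  rw [hL y]
  exact forall₂_congr fun c hc => ⟨fun h => h _ (hnum c), fun h a ha =>
    ((ha.associated (hS c hc) (hnum c)).dvd).trans h⟩

/-- This crude bound suffices to show that `L` is non-zero and that its prime divisors divide some
numerator. -/
theorem IsLcmOfNumerators.dvd_prod {S : Finset K} {L : 𝓞 K} (hL : IsLcmOfNumerators S L)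
    (hS : ∀ c ∈ S, c ≠ 0) {num : K → 𝓞 K} (hnum : ∀ c, IsNumerator c (num c)) :
    L ∣ ∏ c ∈ S, num c :=
  (hL.dvd_iff hS hnum _).mpr fun _ hc => Finset.dvd_prod_of_mem num hc

theorem IsLcmOfNumerators.ne_zero {S : Finset K} {L : 𝓞 K} (hL : IsLcmOfNumerators S L)
    (hS : ∀ c ∈ S, c ≠ 0) : L ≠ 0 := by
  choose num hnum using exists_isNumerator
  rintro rfl
  have h := zero_dvd_iff.mp (hL.dvd_prod hS hnum)
  obtain ⟨c, hc, h0⟩ := Finset.prod_eq_zero_iff.mp h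
  exact (hnum c).ne_zero (hS c hc) h0

theorem IsLcmOfNumerators.not_dvd {S : Finset K} {L : 𝓞 K} (hL : IsLcmOfNumerators S L)
    (hS : ∀ c ∈ S, c ≠ 0) {q : 𝓞 K} (hq : Prime q) (hSq : ∀ c ∈ S, IsLocalUnit q c) :
    ¬ q ∣ L := by
  choose num hnum using exists_isNumerator
  intro h
  obtain ⟨c, hc, hqc⟩ := hq.exists_mem_finset_dvd (h.trans (hL.dvd_prod hS hnum))
  exact (hSq c hc).not_dvd hq (hnum c) hqc

/-! ### Windows -/

theorem jordanMeasurable_smul {W : Set ℂ} (hW : JordanMeasurable W) {t : ℝ} (ht : t ≠ 0) :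
    JordanMeasurable (t • W) := by
  refine ⟨hW.1.smul₀ t, ?_⟩
  have : frontier (t • W) = t • frontier W := by
    rw [frontier, frontier, closure_smul₀ t, interior_smul₀ ht, Set.smul_set_sdiff₀ ht]
  rw [this, MeasureTheory.Measure.addHaar_smul, hW.2, mul_zero]

theorem JordanMeasurable.inter {V W : Set ℂ} (hV : JordanMeasurable V)
    (hW : JordanMeasurable W) : JordanMeasurable (V ∩ W) := by
  refine ⟨hV.1.subset Set.inter_subset_left, ?_⟩
  refine MeasureTheory.measure_mono_null (frontier_inter_subset V W)
    (MeasureTheory.measure_union_null ?_ ?_)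
  · exact MeasureTheory.measure_mono_null Set.inter_subset_left hV.2
  · exact MeasureTheory.measure_mono_null Set.inter_subset_right hW.2

theorem mem_windowInter {W : Set ℂ} {S : Finset K} {z : ℂ} :
    z ∈ windowInter W S ↔ z ∈ W ∧ ∀ c ∈ S, z ∈ emb₂ c • W := by
  simp only [windowInter, Set.mem_inter_iff, Set.mem_iInter]
  rfl

theorem jordanMeasurable_windowInter {W : Set ℂ} (hW : JordanMeasurable W) {S : Finset K}
    (hS : ∀ c ∈ S, c ≠ 0) : JordanMeasurable (windowInter W S) := by
  classical
  induction S using Finset.induction_on with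
  | empty =>
    have : windowInter W ∅ = W := by ext z; simp [mem_windowInter]
    rwa [this]
  | insert c S _ ih =>
    have : windowInter W (insert c S) = windowInter W S ∩ emb₂ c • W := by
      ext z
      simp only [mem_windowInter, Set.mem_inter_iff, Finset.forall_mem_insert]
      tauto
    rw [this]
    exact (ih fun d hd => hS d (Finset.mem_insert_of_mem hd)).inter
      (jordanMeasurable_smul hW ((map_ne_zero emb₂).mpr (hS c (Finset.mem_insert_self _ _))))

/-! ### The density of the visible points -/

theorem ncard_inclusion_exclusion {α ι : Type*} {X : Set α} (hX : X.Finite) (M : Finset ι)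
    (R : ι → α → Prop) :
    ({x | x ∈ X ∧ ∀ i ∈ M, ¬ R i x}.ncard : ℝ) =
      ∑ S ∈ M.powerset, (-1) ^ S.card * ({x | x ∈ X ∧ ∀ i ∈ S, R i x}.ncard : ℝ) := by
  classical
  induction M using Finset.induction_on generalizing X with
  | empty => simp
  | insert i M hi ih =>
    have hX' : {x | x ∈ X ∧ R i x}.Finite := hX.subset fun x hx => hx.1
    rw [Finset.sum_powerset_insert hi, ← ih hX]
    have h1 : ∀ S ∈ M.powerset, (-1 : ℝ) ^ (insert i S).card *
        ({x | x ∈ X ∧ ∀ j ∈ insert i S, R j x}.ncard : ℝ) =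
        -((-1) ^ S.card * ({x | x ∈ {x | x ∈ X ∧ R i x} ∧ ∀ j ∈ S, R j x}.ncard : ℝ)) := by
      intro S hS
      have hiS : i ∉ S := fun h => hi (Finset.mem_powerset.mp hS h)
      rw [Finset.card_insert_of_notMem hiS, pow_succ]
      simp only [Finset.forall_mem_insert, Set.mem_ofPred_eq, and_assoc]
      ring
    rw [Finset.sum_congr rfl h1, Finset.sum_neg_distrib, ← ih hX']
    have hunion : {x | x ∈ X ∧ ∀ j ∈ M, ¬ R j x} = {x | x ∈ X ∧ ∀ j ∈ insert i M, ¬ R j x} ∪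
        {x | x ∈ {x | x ∈ X ∧ R i x} ∧ ∀ j ∈ M, ¬ R j x} := by
      ext x
      simp only [Finset.forall_mem_insert, Set.mem_ofPred_eq, Set.mem_union]
      tauto
    have hdisj : Disjoint {x | x ∈ X ∧ ∀ j ∈ insert i M, ¬ R j x}
        {x | x ∈ {x | x ∈ X ∧ R i x} ∧ ∀ j ∈ M, ¬ R j x} := by
      rw [Set.disjoint_left]
      rintro x ⟨-, h⟩ ⟨⟨-, h'⟩, -⟩
      exact h i (Finset.mem_insert_self _ _) h'
    rw [hunion, Set.ncard_union_eq hdisj (hX.subset fun x hx => hx.1)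
      (hX'.subset fun x hx => hx.1)]
    push_cast
    ring

/-- The parameters of the points of `A_W ∩ TD` that do not remain in `A_W` after division by an
element of `M` or of `Q`. -/
def partialVisible (W : Set ℂ) (M : Finset K) (Q : Finset primes) (D : Set ℂ) (T : ℝ) :
    Set (𝓞 K × 𝓞 K) :=
  {p | p ∈ sieveSet Q 1 D W T ∧ ∀ c ∈ M, ¬ pt₁ p / (emb₁ c : ℂ) ∈ ASet W}

-- In the inclusion-exclusion over `M`, the points surviving division by every `c ∈ S` are exactly
-- the multiples of `L S` with conjugate in `windowInter W S`, and each such family has a density by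
-- `tendsto_sieveSet`.
open Filter in
theorem tendsto_partialVisible {W : Set ℂ} (hW : JordanMeasurable W) {M : Finset K}
    (hM : ∀ c ∈ M, c ≠ 0) (Q : Finset primes)
    (hMQ : ∀ c ∈ M, ∀ q ∈ Q, IsLocalUnit (q : 𝓞 K) c) {L : Finset K → 𝓞 K}
    (hL : ∀ S ⊆ M, IsLcmOfNumerators S (L S)) {D : Set ℂ} (hD : JordanMeasurable D)
    (hD0 : 0 < MeasureTheory.volume D) :
    Tendsto (fun T : ℝ => ((partialVisible W M Q D T).ncard : ℝ) /
        MeasureTheory.volume.real (T • D)) atTop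
      (𝓝 ((∑ S ∈ M.powerset, (-1) ^ S.card * MeasureTheory.volume.real (windowInter W S) /
        normK (L S : K) ^ 2) / 4 * ∏ q ∈ Q, (1 - 1 / normK ((q : 𝓞 K) : K) ^ 2))) := by
  choose num hnum using exists_isNumerator
  have hset : ∀ S ⊆ M, ∀ T : ℝ, {p | p ∈ sieveSet Q 1 D W T ∧
      ∀ c ∈ S, pt₁ p / (emb₁ c : ℂ) ∈ ASet W} = sieveSet Q (L S) D (windowInter W S) T := by
    intro S hS T
    have hS0 : ∀ c ∈ S, c ≠ 0 := fun c hc => hM c (hS hc)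
    ext p
    have : (∀ c ∈ S, pt₁ p / (emb₁ c : ℂ) ∈ ASet W) ↔
        ∀ c ∈ S, (num c ∣ p.1 ∧ num c ∣ p.2) ∧ pt₂ p ∈ emb₂ c • W :=
      forall₂_congr fun c hc => div_mem_ASet_iff_dvd (hS0 c hc) (hnum c)
    simp only [sieveSet, Set.mem_ofPred_eq, this, (hL S hS).dvd_iff hS0 hnum, mem_windowInter,
      one_dvd, forall_and, true_and, and_self]
    tauto
  have hlim : ∀ S ∈ M.powerset, Tendsto (fun T : ℝ => (-1 : ℝ) ^ S.card *
      (((sieveSet Q (L S) D (windowInter W S) T).ncard : ℝ) /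
        MeasureTheory.volume.real (T • D))) atTop
      (𝓝 ((-1) ^ S.card * (MeasureTheory.volume.real (windowInter W S) /
        (4 * normK (L S : K) ^ 2) * ∏ q ∈ Q, (1 - 1 / normK ((q : 𝓞 K) : K) ^ 2)))) := by
    intro S hS
    rw [Finset.mem_powerset] at hS
    have hS0 : ∀ c ∈ S, c ≠ 0 := fun c hc => hM c (hS hc)
    exact (tendsto_sieveSet Q ((hL S hS).ne_zero hS0)
      (fun q hq => (hL S hS).not_dvd hS0 q.2.1 fun c hc => hMQ c (hS hc) q hq) hD hD0
      (jordanMeasurable_windowInter hW hS0)).const_mul _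
  have h := tendsto_finsetSum _ hlim
  have e : ∑ S ∈ M.powerset, (-1) ^ S.card * (MeasureTheory.volume.real (windowInter W S) /
        (4 * normK (L S : K) ^ 2) * ∏ q ∈ Q, (1 - 1 / normK ((q : 𝓞 K) : K) ^ 2)) =
      (∑ S ∈ M.powerset, (-1) ^ S.card * MeasureTheory.volume.real (windowInter W S) /
        normK (L S : K) ^ 2) / 4 * ∏ q ∈ Q, (1 - 1 / normK ((q : 𝓞 K) : K) ^ 2) := by
    rw [Finset.sum_div, Finset.sum_mul]
    refine Finset.sum_congr rfl fun S _ => ?_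
    rw [← div_div (MeasureTheory.volume.real (windowInter W S))]
    ring
  rw [e] at h
  refine h.congr fun T => ?_
  rw [partialVisible, ncard_inclusion_exclusion (finite_sieveSet Q 1 hD.1 hW.1 T) M
    (fun c p => pt₁ p / (emb₁ c : ℂ) ∈ ASet W), Finset.sum_div]
  refine Finset.sum_congr rfl fun S hS => ?_
  rw [hset S (Finset.mem_powerset.mp hS) T, mul_div_assoc]

/-- The parameters of the visible points of `A_W`. -/
def visibleParams (W : Set ℂ) (r : ℝ) (M : Finset K) : Set (𝓞 K × 𝓞 K) :=
  {p | pt₂ p ∈ W ∧ (∀ q ∈ primes, q ∉ smallPrimes r → ¬ (q ∣ p.1 ∧ q ∣ p.2)) ∧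
    ∀ c ∈ M, ¬ pt₁ p / (emb₁ c : ℂ) ∈ ASet W}

/-- Since `|σ(q)| > r` for a prime `q` outside `P`, the window condition for division by `q` always
holds, and only divisibility has to be excluded. -/
theorem visible_ASet_eq {W : Set ℂ} (hstar : StarConvex ℝ 0 W) {r : ℝ} (hr : 1 ≤ r)
    (hneg : -W ⊆ r • W) {M : Finset K}
    (hM : IsOcclusionQuotients (ASet W) (candidateSet r M)) :
    visible (ASet W) = pt₁ '' visibleParams W r M := by
  have hprime : ∀ q ∈ primes, q ∉ smallPrimes r → ∀ p, pt₂ p ∈ W →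
      (pt₁ p / (emb₁ (q : K) : ℂ) ∈ ASet W ↔ q ∣ p.1 ∧ q ∣ p.2) := by
    intro q hq hqr p hp
    rw [div_mem_ASet_iff_dvd (coe_ne_zero hq.1.ne_zero) (isNumerator_coe q)]
    refine and_iff_left (mem_smul_of_le_abs hstar hr hneg ?_ hp)
    by_contra! hlt
    exact hqr (mem_smallPrimes.mpr ⟨hq, hlt.le⟩)
  have hvis : ∀ x ∈ visible (ASet W), ∀ c ∈ candidateSet r M, x / (c : ℂ) ∉ ASet W := by
    intro x hx c hc h
    have hc1 := hM.1 c hc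
    refine hx.2 c⁻¹ (by positivity) (inv_lt_one_of_one_lt₀ hc1) ?_
    rwa [Complex.ofReal_inv, ← div_eq_inv_mul]
  ext x
  constructor
  · intro hx
    obtain ⟨p, rfl, hp⟩ := mem_ASet.mp hx.1
    refine ⟨p, ⟨hp, fun q hq hqr hd => ?_, fun c hc => ?_⟩, rfl⟩
    · exact hvis _ hx _ (mem_candidateSet.mpr (Or.inl ⟨q, hq, hqr, rfl⟩))
        ((hprime q hq hqr p hp).mpr hd)
    · exact hvis _ hx _ (mem_candidateSet.mpr (Or.inr ⟨c, hc, rfl⟩))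
  · rintro ⟨p, ⟨hp, hpq, hpM⟩, rfl⟩
    by_contra hx
    obtain ⟨c, hc, h⟩ := hM.2 _ ⟨pt₁_mem_ASet.mpr hp, hx⟩
    rcases mem_candidateSet.mp hc with ⟨q, hq, hqr, rfl⟩ | ⟨c, hcM, rfl⟩
    · exact hpq q hq hqr ((hprime q hq hqr p hp).mp h)
    · exact hpM c hcM h

/-- A point wrongly counted as visible is divisible by a prime outside `P` and `Q`, so a union bound
over such primes applies. The origin, divisible by all of them, is the summand 1. -/
theorem ncard_partialVisible_sdiff_le {W : Set ℂ} (hW : Bornology.IsBounded W) {r : ℝ}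
    {M : Finset K} {Q : Finset primes} {D : Set ℂ} (hD : Bornology.IsBounded D) {T C η : ℝ}
    (hC : 0 ≤ C) (hT : 0 < T)
    (hCL : ∀ L : 𝓞 K, L ≠ 0 →
      ((sieveSet ∅ L D W T \ {0}).ncard : ℝ) ≤ C * T ^ 2 * (1 / normK (L : K) ^ 2))
    (hη : ∀ Q' : Finset primes, (∀ q ∈ Q', (q : 𝓞 K) ∉ smallPrimes r ∧ q ∉ Q) →
      ∑ q ∈ Q', 1 / normK ((q : 𝓞 K) : K) ^ 2 ≤ η) :
    ((partialVisible W M Q D T \ visibleParams W r M).ncard : ℝ) ≤ 1 + C * T ^ 2 * η := by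
  classical
  set A := (partialVisible W M Q D T \ visibleParams W r M) \ {0} with hA
  have hfin : (partialVisible W M Q D T \ visibleParams W r M).Finite :=
    (finite_sieveSet Q 1 hD hW T).subset fun p hp => hp.1.1
  have hAfin : A.Finite := hfin.subset Set.sdiff_subset
  have hex : ∀ p : A, ∃ q : primes, ((q : 𝓞 K) ∉ smallPrimes r ∧ q ∉ Q) ∧
      (q : 𝓞 K) ∣ p.1.1 ∧ (q : 𝓞 K) ∣ p.1.2 := by
    rintro ⟨p, ⟨⟨hp1, hp2⟩, hp3⟩, -⟩
    by_contra! hcon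
    refine hp3 ⟨hp1.2.2.2, fun q hq hqr hd => ?_, hp2⟩
    have hqQ : (⟨q, hq⟩ : primes) ∉ Q := fun hqQ => hp1.2.1 _ hqQ hd
    exact hcon ⟨q, hq⟩ ⟨hqr, hqQ⟩ hd.1 hd.2
  choose φ hφ1 hφ2 using hex
  have := hAfin.to_subtype
  set Q' := (Set.finite_range φ).toFinset with hQ'
  have hsub : A ⊆ ⋃ q ∈ Q', (sieveSet ∅ (q : 𝓞 K) D W T \ {0}) := by
    intro p hp
    simp only [Set.mem_iUnion]
    refine ⟨φ ⟨p, hp⟩, (Set.finite_range φ).mem_toFinset.mpr ⟨_, rfl⟩,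
      ⟨hφ2 ⟨p, hp⟩, by simp, ?_⟩, hp.2⟩
    exact hp.1.1.1.2.2
  have h1 : A.ncard ≤ ∑ q ∈ Q', (sieveSet ∅ (q : 𝓞 K) D W T \ {0}).ncard := by
    refine (Set.ncard_le_ncard hsub ?_).trans (Finset.set_ncard_biUnion_le _ _)
    exact Q'.finite_toSet.biUnion fun q _ =>
      (finite_sieveSet _ _ hD hW T).subset Set.sdiff_subset
  have h2 : (A.ncard : ℝ) ≤ C * T ^ 2 * η := by
    calc (A.ncard : ℝ) ≤ ∑ q ∈ Q', ((sieveSet ∅ (q : 𝓞 K) D W T \ {0}).ncard : ℝ) := by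
          exact_mod_cast h1
      _ ≤ ∑ q ∈ Q', C * T ^ 2 * (1 / normK ((q : 𝓞 K) : K) ^ 2) :=
          Finset.sum_le_sum fun q _ => hCL _ q.2.1.ne_zero
      _ ≤ C * T ^ 2 * η := by
          rw [← Finset.mul_sum]
          refine mul_le_mul_of_nonneg_left (hη Q' fun q hq => ?_) (by positivity)
          obtain ⟨p, rfl⟩ := (Set.finite_range φ).mem_toFinset.mp hq
          exact hφ1 p
  have h3 : (partialVisible W M Q D T \ visibleParams W r M).ncard ≤ A.ncard + 1 :=
    Set.ncard_le_ncard_sdiff_add_ncard _ {0} |>.trans (by simp [hA])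
  have h3' : ((partialVisible W M Q D T \ visibleParams W r M).ncard : ℝ) ≤ A.ncard + 1 := by
    exact_mod_cast h3
  linarith

-- The factors at `P` may be divided out of the Euler product: both embeddings of such a prime
-- exceed 1 in modulus, so none of these factors vanishes.
open Filter in
open Classical in
theorem tendsto_prod_filter_primes (r : ℝ) :
    Tendsto (fun Q : Finset primes =>
        ∏ q ∈ Q.filter (fun q : primes => (q : 𝓞 K) ∉ smallPrimes r), (1 - 1 / normK ((q : 𝓞 K) : K) ^ 2)) atTop
      (𝓝 ((NumberField.dedekindZeta K 2).re *
        ∏ p ∈ smallPrimes r, (1 - 1 / normK (p : K) ^ 2))⁻¹) := by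
  have hne : ∏ p ∈ smallPrimes r, (1 - 1 / normK (p : K) ^ 2) ≠ 0 := by
    refine Finset.prod_ne_zero_iff.mpr fun p hp => ?_
    have hp' := mem_primes.mp (mem_smallPrimes.mp hp).1
    have h2 : 1 < |normK (p : K)| := by
      rw [normK_eq, abs_mul, abs_of_pos (by linarith [hp'.2.1])]
      exact one_lt_mul_of_lt_of_le hp'.2.1 (one_lt_abs_emb₂ hp'.2.1 hp'.2.2).le
    have h3 : 1 < normK (p : K) ^ 2 := by
      rw [← sq_abs]; exact one_lt_pow₀ h2 two_ne_zero
    exact (sub_pos.mpr ((div_lt_one (by linarith)).mpr h3)).ne'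
  have h := tendsto_prod_primes.mul_const (∏ p ∈ smallPrimes r, (1 - 1 / normK (p : K) ^ 2))⁻¹
  rw [← mul_inv] at h
  refine h.congr' ?_
  filter_upwards [eventually_ge_atTop ((smallPrimes r).subtype (· ∈ primes))] with Q hQ
  have hfilter : Q.filter (fun q : primes => (q : 𝓞 K) ∈ smallPrimes r) =
      (smallPrimes r).subtype (· ∈ primes) := by
    ext q
    rw [Finset.mem_filter, Finset.mem_subtype]
    exact ⟨fun h => h.2, fun h => ⟨hQ (Finset.mem_subtype.mpr h), h⟩⟩
  rw [← Finset.prod_filter_mul_prod_filter_not Q (fun q : primes => (q : 𝓞 K) ∈ smallPrimes r), hfilter,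
    Finset.prod_subtype_of_mem (fun p : 𝓞 K => 1 - 1 / normK (p : K) ^ 2)
      (fun p hp => (mem_smallPrimes.mp hp).1), mul_comm, inv_mul_cancel_left₀ hne]

theorem finite_visible_inter {W : Set ℂ} (hW : Bornology.IsBounded W) {B : Set ℂ}
    (hB : Bornology.IsBounded B) : (visible (ASet W) ∩ B).Finite := by
  refine ((finite_ptSet one_ne_zero one_ne_zero hB hW).image pt₁).subset ?_
  rintro x ⟨hx, hxB⟩
  obtain ⟨p, rfl, hp⟩ := mem_ASet.mp hx.1
  exact ⟨p, ⟨by simpa using hxB, by simpa using hp⟩, rfl⟩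

-- For fixed `Q` the partial sieve has a known density; the points it wrongly retains have
-- proportion bounded, uniformly in large `T`, by the tail of `∑ N(q)⁻²`. So `Q` is chosen first,
-- and `T` afterwards.
open Filter in
theorem hasDensity_visible {W : Set ℂ} (hW : JordanMeasurable W) (hstar : StarConvex ℝ 0 W)
    {r : ℝ} (hr : 1 ≤ r) (hneg : -W ⊆ r • W) {M : Finset K}
    (hM : IsOcclusionQuotients (ASet W) (candidateSet r M))
    (hMQ : ∀ c ∈ M, ∀ q ∈ primes, q ∉ smallPrimes r → IsLocalUnit q c) {L : Finset K → 𝓞 K}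
    (hL : ∀ S ⊆ M, IsLcmOfNumerators S (L S)) :
    HasDensity (visible (ASet W))
      ((4 * (NumberField.dedekindZeta K 2).re *
          ∏ p ∈ smallPrimes r, (1 - 1 / normK (p : K) ^ 2))⁻¹ *
        ∑ S ∈ M.powerset, (-1) ^ S.card * MeasureTheory.volume.real (windowInter W S) /
          normK (L S : K) ^ 2) := by
  classical
  refine ⟨fun B hB => finite_visible_inter hW.1 hB, fun D hD hD0 => ?_⟩
  have hM0 : ∀ c ∈ M, c ≠ 0 := by
    rintro c hc rfl
    have h : (1 : ℝ) < emb₁ 0 := hM.1 _ (mem_candidateSet.mpr (Or.inr ⟨0, hc, rfl⟩))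
    rw [map_zero] at h
    linarith
  set d := MeasureTheory.volume.real D
  have hdpos : 0 < d := hD.volume_real_pos hD0
  set κ := ∑ S ∈ M.powerset, (-1) ^ S.card * MeasureTheory.volume.real (windowInter W S) /
    normK (L S : K) ^ 2
  set good : Finset primes → Finset primes :=
    fun Q => Q.filter (fun q : primes => (q : 𝓞 K) ∉ smallPrimes r)
  have hθlim := (tendsto_prod_filter_primes r).const_mul (κ / 4)
  rw [show κ / 4 * ((NumberField.dedekindZeta K 2).re *
      ∏ p ∈ smallPrimes r, (1 - 1 / normK (p : K) ^ 2))⁻¹ =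
    (4 * (NumberField.dedekindZeta K 2).re *
      ∏ p ∈ smallPrimes r, (1 - 1 / normK (p : K) ^ 2))⁻¹ * κ by
    rw [mul_assoc (4 : ℝ), mul_inv (4 : ℝ)]; ring] at hθlim
  set θ₀ := (4 * (NumberField.dedekindZeta K 2).re *
      ∏ p ∈ smallPrimes r, (1 - 1 / normK (p : K) ^ 2))⁻¹ * κ
  obtain ⟨C, hC, hCL⟩ := exists_ncard_multiples_le hD.1 hW.1
  rw [Metric.tendsto_nhds]
  intro ε hε
  -- This gives `C * η ≤ ε * d / 6`, with `C + 1` guarding against `C = 0`. The other `ε / 6` of the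
  -- error is reserved for the origin, which is why `T ^ 2 * d > 6 / ε` is demanded below.
  set η := ε * d / (6 * (C + 1)) with hη
  have hηpos : 0 < η := by positivity
  obtain ⟨Q₀, hQ₀⟩ := summable_iff_vanishing_norm.mp summable_primes η hηpos
  obtain ⟨Q, hQ, hQQ₀⟩ := ((Metric.tendsto_nhds.mp hθlim (ε / 3) (by positivity)).and
    (eventually_ge_atTop Q₀)).exists
  have htail : ∀ Q' : Finset primes, (∀ q ∈ Q', (q : 𝓞 K) ∉ smallPrimes r ∧ q ∉ good Q) →
      ∑ q ∈ Q', 1 / normK ((q : 𝓞 K) : K) ^ 2 ≤ η := by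
    intro Q' hQ'
    refine (le_abs_self _).trans (hQ₀ Q' (Finset.disjoint_left.mpr fun q hq hq0 => ?_)).le
    exact (hQ' q hq).2 (Finset.mem_filter.mpr ⟨hQQ₀ hq0, (hQ' q hq).1⟩)
  have hlim := tendsto_partialVisible hW hM0 (good Q)
    (fun c hc q hq => hMQ c hc q q.2 (Finset.mem_filter.mp hq).2) hL hD hD0
  have hsq : Tendsto (fun T : ℝ => T ^ 2 * d) atTop atTop :=
    (tendsto_pow_atTop two_ne_zero).atTop_mul_const hdpos
  filter_upwards [Metric.tendsto_nhds.mp hlim (ε / 3) (by positivity), eventually_gt_atTop 0,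
    hsq.eventually_gt_atTop (6 / ε)] with T hT1 hT0 hT2
  set P := partialVisible W M (good Q) D T with hP
  have hPfin : P.Finite := (finite_sieveSet _ 1 hD.1 hW.1 T).subset fun p hp => hp.1
  have hcount : visible (ASet W) ∩ T • D = pt₁ '' (P ∩ visibleParams W r M) := by
    rw [visible_ASet_eq hstar hr hneg hM]
    ext x
    constructor
    · rintro ⟨⟨p, hp, rfl⟩, hx⟩
      refine ⟨p, ⟨⟨⟨⟨one_dvd _, one_dvd _⟩, fun q hq => ?_, hx, hp.1⟩, hp.2.2⟩, hp⟩, rfl⟩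
      exact hp.2.1 q q.2 (Finset.mem_filter.mp hq).2
    · rintro ⟨p, ⟨hp1, hp2⟩, rfl⟩
      exact ⟨⟨p, hp2, rfl⟩, hp1.1.2.2.1⟩
  have hsplit : ((visible (ASet W) ∩ T • D).ncard : ℝ) + (P \ visibleParams W r M).ncard =
      P.ncard := by
    rw [hcount, Set.ncard_image_of_injective _ pt₁_injective]
    exact_mod_cast Set.ncard_inter_add_ncard_sdiff_eq_ncard P _ hPfin
  have hdiff := ncard_partialVisible_sdiff_le (M := M) hW.1 hD.1 hC hT0
    (fun L hL => hCL L hL T hT0) htail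
  have hvol : MeasureTheory.volume.real (T • D) = T ^ 2 * d := volume_real_smul T D
  rw [hvol] at hT1 ⊢
  have hvpos : 0 < T ^ 2 * d := by positivity
  have hsmall : ((P \ visibleParams W r M).ncard : ℝ) / (T ^ 2 * d) ≤ ε / 3 := by
    rw [div_le_iff₀ hvpos]
    refine hdiff.trans ?_
    have e1 : C * η ≤ ε * d / 6 := by
      rw [hη, ← mul_div_assoc, div_le_div_iff₀ (by positivity) (by norm_num)]
      nlinarith [mul_pos hε hdpos]
    have e2 : 6 < T ^ 2 * d * ε := (div_lt_iff₀ hε).mp hT2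
    have e3 : C * T ^ 2 * η ≤ T ^ 2 * (ε * d / 6) := by
      rw [mul_right_comm, mul_comm]
      exact mul_le_mul_of_nonneg_left e1 (by positivity)
    nlinarith
  have hsmall0 : 0 ≤ ((P \ visibleParams W r M).ncard : ℝ) / (T ^ 2 * d) := by positivity
  have hfrac : ((visible (ASet W) ∩ T • D).ncard : ℝ) / (T ^ 2 * d) =
      P.ncard / (T ^ 2 * d) - (P \ visibleParams W r M).ncard / (T ^ 2 * d) := by
    rw [← hsplit]; ring
  rw [Real.dist_eq, abs_lt] at hQ hT1 ⊢
  rw [hfrac]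
  constructor <;> linarith [hQ.1, hQ.2, hT1.1, hT1.2]

end AmmannBeenker

end

open AmmannBeenker in
theorem mainTheorem2 (W : Set ℂ) (hW : JordanMeasurable W) (hstar : StarConvex ℝ 0 W)
    (hnhds : W ∈ 𝓝 (0 : ℂ)) (r : ℝ) (hr : 1 ≤ r) (hneg : -W ⊆ r • W) :
    (∃ (k₀ k₁ : ℤ) (m : smallPrimes r → ℤ), k₀ ≤ 0 ∧
      IsOcclusionQuotients (ASet W) (candidateSet r (quotientSet r k₀ k₁ m))) ∧
    ∀ (k₀ k₁ : ℤ) (m : smallPrimes r → ℤ), k₀ ≤ 0 →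
      IsOcclusionQuotients (ASet W) (candidateSet r (quotientSet r k₀ k₁ m)) →
      (∃ L : Finset K → 𝓞 K,
        ∀ M₀ ⊆ quotientSet r k₀ k₁ m, IsLcmOfNumerators M₀ (L M₀)) ∧
      ∀ L : Finset K → 𝓞 K,
        (∀ M₀ ⊆ quotientSet r k₀ k₁ m, IsLcmOfNumerators M₀ (L M₀)) →
        HasDensity (visible (ASet W))
          ((4 * (NumberField.dedekindZeta K 2).re *
              ∏ p ∈ smallPrimes r, (1 - 1 / normK (p : K) ^ 2))⁻¹ *
            ∑ M₀ ∈ (quotientSet r k₀ k₁ m).powerset,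
              (-1) ^ M₀.card * MeasureTheory.volume.real (windowInter W M₀) /
                normK (L M₀ : K) ^ 2) := by
  refine ⟨exists_isOcclusionQuotients hW.1 hstar hnhds hr hneg, fun k₀ k₁ m _ hM => ⟨?_, ?_⟩⟩
  · choose L hL using exists_isLcmOfNumerators
    exact ⟨L, fun S _ => hL S⟩
  · intro L hL
    exact hasDensity_visible hW hstar hr hneg hM
      (fun c hc q hq hqr => isLocalUnit_of_mem_quotientSet hc hq hqr) hL
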